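/- **Lemma 3 (linear decay of the LOCO bias).** Let $p\ge 1$ and $j\in\{1,\dots,p\}$. Let $P_0$ be the law of $(X,y)$ with $X\sim\mathcal N(\mu,\Sigma)$ in $\mathbb R^p$, $\Sigma$ positive definite, and $y=X\beta+\epsilon$, where $\beta\in\mathbb R^p$ and $\epsilon\sim\mathcal N(0,\sigma^2)$ ($\sigma\ge 0$) is independent of $X$. Let $X^{-j}$ denote $X$ without its $j$-th coordinate, and assume the conditional null hypothesis $X^j\perp\!\!\!\perp y\mid X^{-j}$. For each $n=n_{\mathrm{train}}$ let $\mathcal D_n$ and $\mathcal D_n'$ be i.i.d. samples of size $n$ from $P_0$ (possibly $\mathcal D_n'=\mathcal D_n$; their dependence is arbitrary) and let $(x_i,y_i)_{i\le n_{\mathrm{test}}}$, $n_{\mathrm{test}}\ge 1$ (possibly depending on $n$), be an i.i.d. test sample from $P_0$ that is independent of $\mathcal D_n$ and independent of $\mathcal D_n'$. Let $\widehat m(x)=x\widehat\beta$ be the ordinary least squares fit (without intercept) of $y$ on $X$ over $\mathcal D_n$, where $\widehat\beta=(X_{\mathrm{tr}}^\top X_{\mathrm{tr}})^{-1}X_{\mathrm{tr}}^\top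 y_{\mathrm{tr}}$, let $\widehat m_{-j}$ be the ordinary least squares fit of $y$ on $X^{-j}$ over $\mathcal D_n'$, and put $$\widehat\psi_{\mathrm{LOCO}}(j)=\frac1{n_{\mathrm{test}}}\sum_{i=1}^{n_{\mathrm{test}}}\Big[\big(\widehat m_{-j}(x_i^{-j})-y_i\big)^2-\big(\widehat m(x_i)-y_i\big)^2\Big],$$ $$\psi_{\mathrm{TSI}}(j)=\mathbb E\big[(\mathbb E[y\mid X^{-j}]-y)^2\big]-\mathbb E\big[(\mathbb E[y\mid X]-y)^2\big].$$ Then $\widehat\psi_{\mathrm{LOCO}}(j)$ is integrable for all large $n_{\mathrm{train}}$, $\psi_{\mathrm{TSI}}(j)=0$, and $$\mathbb E[\widehat\psi_{\mathrm{LOCO}}(j)]=\psi_{\mathrm{TSI}}(j)+O(1/n_{\mathrm{train}})=O(1/n_{\mathrm{train}}).$$ If moreover $\mu=0$, then for every $n=n_{\mathrm{train}}\ge p+2$ the statistic is integrable and its bias is exactly $$\mathbb E[\widehat\psi_{\mathrm{LOCO}}(j)]-\psi_{\mathrm{TSI}}(j)=\sigma^2\left(\frac{p-1}{n-p}-\frac{p}{n-p-1}\right);$$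 hence $n_{\mathrm{train}}\,\mathbb E[\widehat\psi_{\mathrm{LOCO}}(j)]\to-\sigma^2$ as $n_{\mathrm{train}}\to\infty$, so that for $\sigma>0$ the decay is linear and not faster. -/

import Mathlib

open MeasureTheory ProbabilityTheory Filter Asymptotics
open scoped Matrix NNReal Topology

noncomputable section

/-- An observation `(x, y)`: a covariate vector `x ∈ ℝ^p` and a real response `y`. -/
abbrev Obs (p : ℕ) : Type := EuclideanSpace ℝ (Fin p) × ℝ

/-- `x^{-j}`: the vector `x` without its `j`-th coordinate. -/
def dropCoord {p : ℕ} (j : Fin p) (x : EuclideanSpace ℝ (Fin p)) : {k : Fin p // k ≠ j} → ℝ :=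
  fun k => x k.1

theorem measurable_dropCoord {p : ℕ} (j : Fin p) : Measurable (dropCoord j) := by
  unfold dropCoord
  fun_prop

/-- The law of `(X, y)` in the Gaussian linear model: `X ∼ N(μ, S)`, `y = X β + ε` with
`ε ∼ N(0, σ²)` independent of `X`. -/
def gaussianLinearModel {p : ℕ} (μ : EuclideanSpace ℝ (Fin p)) (S : Matrix (Fin p) (Fin p) ℝ)
    (β : Fin p → ℝ) (σ : ℝ≥0) : Measure (Obs p) :=
  ((multivariateGaussian μ S).prod (gaussianReal 0 (σ ^ 2))).map
    (fun z => (z.1, z.1.ofLp ⬝ᵥ β + z.2))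

instance isProbabilityMeasure_gaussianLinearModel {p : ℕ} (μ : EuclideanSpace ℝ (Fin p))
    (S : Matrix (Fin p) (Fin p) ℝ) (β : Fin p → ℝ) (σ : ℝ≥0) :
    IsProbabilityMeasure (gaussianLinearModel μ S β σ) := by
  unfold gaussianLinearModel
  refine Measure.isProbabilityMeasure_map (Measurable.aemeasurable ?_)
  unfold dotProduct
  fun_prop

/-- The sigma-algebra generated by `X` on the space of observations. -/
abbrev sigmaX (p : ℕ) : MeasurableSpace (Obs p) :=
  MeasurableSpace.comap (fun z : Obs p => z.1) inferInstance

/-- The sigma-algebra generated by `X^{-j}` on the space of observations. -/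
abbrev sigmaDrop {p : ℕ} (j : Fin p) : MeasurableSpace (Obs p) :=
  MeasurableSpace.comap (fun z : Obs p => dropCoord j z.1) inferInstance

theorem sigmaDrop_le {p : ℕ} (j : Fin p) :
    sigmaDrop j ≤ (inferInstance : MeasurableSpace (Obs p)) :=
  ((measurable_dropCoord j).comp measurable_fst).comap_le

/-- The conditional null hypothesis for the coordinate `j`: `X^j` and `y` are conditionally
independent given `X^{-j}` when `(X, y) ∼ P`. -/
def ConditionalNull {p : ℕ} (P : Measure (Obs p)) [IsFiniteMeasure P] (j : Fin p) : Prop :=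
  CondIndepFun (sigmaDrop j) (sigmaDrop_le j) (fun z : Obs p => z.1 j) (fun z : Obs p => z.2) P

/-- The quadratic loss `ℓ(prediction, response)`. -/
def quadraticLoss (a b : ℝ) : ℝ := (a - b) ^ 2

/-- The total Sobol index
`E[ℓ(m_{-j}(X^{-j}), y)] - E[ℓ(m(X), y)]`, where `m(X) = E[y | X]` and
`m_{-j}(X^{-j}) = E[y | X^{-j}]`. -/
def totalSobolIndex {p : ℕ} (loss : ℝ → ℝ → ℝ) (P : Measure (Obs p)) (j : Fin p) : ℝ :=
  (∫ z, loss ((P[fun w : Obs p => w.2 | sigmaDrop j]) z) z.2 ∂P)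
    - ∫ z, loss ((P[fun w : Obs p => w.2 | sigmaX p]) z) z.2 ∂P

/-- The LOCO importance of the coordinate `j`, for a regressor `m` of `y` given `X`, a regressor
`m'` of `y` given `X^{-j}` and a test sample of size `N`. -/
def loco {p N : ℕ} (loss : ℝ → ℝ → ℝ) (j : Fin p) (m : (Fin p → ℝ) → ℝ)
    (m' : ({k : Fin p // k ≠ j} → ℝ) → ℝ) (test : Fin N → Obs p) : ℝ :=
  (1 / (N : ℝ)) * ∑ i, (loss (m' (dropCoord j (test i).1)) (test i).2
    - loss (m (test i).1.ofLp) (test i).2)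

/-- The ordinary least squares coefficients `(AᵀA)⁻¹ Aᵀ y` (without intercept) for the design
matrix `A` and the responses `y`. -/
def ols {n : ℕ} {κ : Type} [Fintype κ] [DecidableEq κ] (A : Matrix (Fin n) κ ℝ)
    (y : Fin n → ℝ) : κ → ℝ :=
  (Aᵀ * A)⁻¹ *ᵥ (Aᵀ *ᵥ y)

/-- The linear regressor of `y` given `X` fitted by least squares on a training sample. -/
def olsFull {p n : ℕ} (train : Fin n → Obs p) (x : Fin p → ℝ) : ℝ :=
  x ⬝ᵥ ols (Matrix.of fun i k => (train i).1 k) (fun i => (train i).2)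

/-- The linear regressor of `y` given `X^{-j}` fitted by least squares on a training sample. -/
def olsDrop {p n : ℕ} (j : Fin p) (train : Fin n → Obs p) (x : {k : Fin p // k ≠ j} → ℝ) : ℝ :=
  x ⬝ᵥ ols (Matrix.of fun i => dropCoord j (train i).1) (fun i => (train i).2)

/-- The LOCO statistic with the quadratic loss, where the full regressor is fitted on `train`, the
restricted one on `train'`, and the losses are averaged over `test`. The usual single-training-set
statistic is the case `train' = train`. -/
def locoOLS {p n N : ℕ} (j : Fin p) (train train' : Fin n → Obs p) (test : Fin N → Obs p) : ℝ :=
  loco quadraticLoss j (olsFull train) (olsDrop j train') test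

end

/-! The conditional null forces `β j = 0`. For `v = S⁻¹ e_j` the variable `u = x · v` is
uncorrelated with, hence independent of, `X^{-j}`, while `cov(u, y) = β j`; conditional independence
of `X^j` and `y` makes this covariance vanish (`coef_eq_zero_of_conditionalNull`). Consequently the
regression functions given `X` and given `X^{-j}` coincide, the total Sobol index is zero, and both
least squares fits are well specified with the same noise level.

For a well-specified fit with `k` covariates, least squares reproduces the linear signal exactly, so
the error at a test point `x` is `σ (⟪dualVector a x, ε⟫ - ε_test)`, where `a` is the family of
columns of the design and `dualVector a x` is the vector of `span a` with inner products `x l`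
against them. Averaging over the noise gives the risk `σ² (1 + excessRisk)`, where `excessRisk` is
the mean of `‖dualVector a x‖² = xᵀ (AᵀA)⁻¹ x`. The bias of LOCO is therefore `σ²` times a
difference of two excess risks; by linearity of expectation, neither the joint law of the two
training samples nor the size of the test sample matters (`integral_locoOLS`).

For centred covariates the covariance matrix cancels, and the excess risk is the mean trace of `G⁻¹`
for a standard Gaussian Gram matrix `G`. A diagonal entry of `G⁻¹` is one over the squared distance
of a column to the span of the others, that is, one over a chi-square variable with `n - k + 1`
degrees of freedom, of mean `1 / (n - k - 1)` (`lintegral_inv_gram_apply_self`). So the excess risk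
is `k / (n - k - 1)`; taking `k = p - 1` and `k = p` gives the exact bias and its limit.

For a general mean, projecting the columns away from the constant vector removes the mean and can
only lengthen the dual vectors. This bounds the excess risk by a centred one in dimension `n - 1`,
which is `O(1/n)` (`lintegral_norm_sq_dualVector_le`). -/

/-! ### Standard Gaussian vectors: Laplace transform, projections and inverse moment of the squared
norm. -/

theorem integral_exp_neg_mul_sq_gaussianReal {t : ℝ} (ht : 0 ≤ t) :
    ∫ x, Real.exp (-t * x ^ 2) ∂(gaussianReal 0 1) = (1 + 2 * t) ^ (-(1 / 2) : ℝ) := by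
  rw [integral_gaussianReal_eq_integral_smul one_ne_zero]
  have h : ∀ x : ℝ, gaussianPDFReal 0 1 x • Real.exp (-t * x ^ 2)
      = (√(2 * Real.pi))⁻¹ * Real.exp (-(1 / 2 + t) * x ^ 2) := by
    intro x
    simp only [gaussianPDFReal, smul_eq_mul, NNReal.coe_one, mul_one, sub_zero]
    rw [mul_assoc, ← Real.exp_add]
    congr 2
    ring
  simp_rw [h]
  rw [integral_const_mul, integral_gaussian, Real.rpow_neg (by positivity), ← Real.sqrt_eq_rpow,
    ← Real.sqrt_inv, ← Real.sqrt_inv, ← Real.sqrt_mul (by positivity)]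
  congr 1
  have : (1 / 2 + t) ≠ 0 := by positivity
  have : (1 + 2 * t) ≠ 0 := by positivity
  have := Real.pi_ne_zero
  field_simp

section StdGaussian

variable {F : Type*} [NormedAddCommGroup F] [InnerProductSpace ℝ F] [FiniteDimensional ℝ F]
  [MeasurableSpace F] [BorelSpace F]

theorem integral_exp_neg_mul_norm_sq_stdGaussian {t : ℝ} (ht : 0 ≤ t) :
    ∫ z, Real.exp (-t * ‖z‖ ^ 2) ∂(stdGaussian F)
      = (1 + 2 * t) ^ (-((Module.finrank ℝ F : ℝ) / 2)) := by
  rw [stdGaussian, integral_map (Measurable.aemeasurable (by fun_prop))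
    (Measurable.aestronglyMeasurable (by fun_prop))]
  have h : ∀ x : Fin (Module.finrank ℝ F) → ℝ,
      Real.exp (-t * ‖∑ i, x i • stdOrthonormalBasis ℝ F i‖ ^ 2)
        = ∏ i, Real.exp (-t * x i ^ 2) := by
    intro x
    rw [← Real.exp_sum, ← Finset.mul_sum, ← (stdOrthonormalBasis ℝ F).sum_sq_inner_right]
    simp only [Orthonormal.inner_right_fintype (stdOrthonormalBasis ℝ F).orthonormal]
  simp_rw [h]
  rw [integral_fintype_prod_eq_prod (f := fun _ (x : ℝ) => Real.exp (-t * x ^ 2))]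
  simp_rw [integral_exp_neg_mul_sq_gaussianReal ht]
  rw [Finset.prod_const, Finset.card_univ, Fintype.card_fin, ← Real.rpow_natCast,
    ← Real.rpow_mul (by positivity)]
  congr 1
  ring

theorem lintegral_sq_inner_stdGaussian (h : F) :
    ∫⁻ z, ENNReal.ofReal (inner ℝ h z ^ 2) ∂(stdGaussian F) = ENNReal.ofReal (‖h‖ ^ 2) := by
  have hL : MemLp (innerSL ℝ h) 2 (stdGaussian F) := IsGaussian.memLp_dual _ _ _ (by simp)
  have hv := variance_dual_stdGaussian (innerSL ℝ h : StrongDual ℝ F)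
  rw [variance_of_integral_eq_zero hL.aestronglyMeasurable.aemeasurable
    (integral_strongDual_stdGaussian _), innerSL_apply_norm] at hv
  rw [← hv, ← ofReal_integral_eq_lintegral_ofReal]
  · rfl
  · exact hL.integrable_sq
  · exact ae_of_all _ fun z => sq_nonneg _

/-- The characteristic function of the image at `t` is that of the source at `L* t`, and the
standard Gaussian characteristic function depends on the norm only. -/
theorem map_stdGaussian_of_adjoint_isometry {G : Type*} [NormedAddCommGroup G]
    [InnerProductSpace ℝ G] [FiniteDimensional ℝ G] [MeasurableSpace G] [BorelSpace G]
    (L : F →L[ℝ] G) (hL : ∀ t, ‖ContinuousLinearMap.adjoint L t‖ = ‖t‖) :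
    (stdGaussian F).map L = stdGaussian G := by
  apply Measure.ext_of_charFun
  ext t
  rw [charFun_stdGaussian, charFun_apply, integral_map (by fun_prop)
    (Measurable.aestronglyMeasurable (by fun_prop)), ← hL t, ← charFun_stdGaussian, charFun_apply]
  simp_rw [ContinuousLinearMap.adjoint_inner_right]

theorem map_orthogonalProjectionOnto_stdGaussian (U : Submodule ℝ F) :
    (stdGaussian F).map U.orthogonalProjectionOnto = stdGaussian U := by
  apply map_stdGaussian_of_adjoint_isometry
  intro t
  rw [Submodule.adjoint_orthogonalProjectionOnto]
  rfl

/-- A nonzero `u` orthogonal to `U` vanishes on `U`, whereas `⟪u, z⟫` has a nondegenerate, hence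
atomless, Gaussian law. -/
theorem stdGaussian_submodule_eq_zero (U : Submodule ℝ F) (hU : U ≠ ⊤) :
    stdGaussian F (U : Set F) = 0 := by
  obtain ⟨u, hu, hu0⟩ : ∃ u ∈ Uᗮ, u ≠ 0 := by
    apply Submodule.exists_mem_ne_zero_of_ne_bot
    rwa [Ne, Submodule.orthogonal_eq_bot_iff]
  have hmap : (stdGaussian F).map (innerSL ℝ u) = gaussianReal 0 (‖u‖ ^ 2).toNNReal := by
    rw [IsGaussian.map_eq_gaussianReal, integral_strongDual_stdGaussian,
      variance_dual_stdGaussian, innerSL_apply_norm]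
  have : NullSingletonClass (gaussianReal 0 (‖u‖ ^ 2).toNNReal) := by
    apply nullSingletonClass_gaussianReal
    simpa using hu0
  have h0 : (stdGaussian F).map (innerSL ℝ u) {0} = 0 := by
    rw [hmap]; exact measure_singleton 0
  rw [Measure.map_apply (by fun_prop) (measurableSet_singleton 0)] at h0
  refine measure_mono_null (fun z hz => ?_) h0
  simp only [Set.mem_preimage, Set.mem_singleton_iff, innerSL_apply_apply]
  exact Submodule.inner_left_of_mem_orthogonal hz hu

/-- Write `1 / r = ∫ exp (-t r) dt` over `t > 0` and exchange the integrals: what remains is the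
integral of the Laplace transform `(1 + 2t)^(-d/2)`, which converges exactly when `d > 2`. -/
theorem lintegral_one_div_norm_sq_stdGaussian (hd : 3 ≤ Module.finrank ℝ F) :
    ∫⁻ z, ENNReal.ofReal (1 / ‖z‖ ^ 2) ∂(stdGaussian F)
      = ENNReal.ofReal (1 / ((Module.finrank ℝ F : ℝ) - 2)) := by
  have hd' : (3 : ℝ) ≤ Module.finrank ℝ F := by exact_mod_cast hd
  have hne : ∀ᵐ z ∂(stdGaussian F), z ≠ 0 := by
    have hbot : (⊥ : Submodule ℝ F) ≠ ⊤ := by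
      intro h
      have := finrank_top ℝ F
      rw [← h, finrank_bot] at this
      omega
    have := stdGaussian_submodule_eq_zero (⊥ : Submodule ℝ F) hbot
    rw [ae_iff]
    simpa using this
  have h1 : ∀ᵐ z ∂(stdGaussian F), ENNReal.ofReal (1 / ‖z‖ ^ 2)
      = ∫⁻ t in Set.Ioi (0 : ℝ), ENNReal.ofReal (Real.exp (-t * ‖z‖ ^ 2)) := by
    filter_upwards [hne] with z hz
    have hz' : 0 < ‖z‖ ^ 2 := by positivity
    have h := integral_exp_mul_Ioi (a := -‖z‖ ^ 2) (by linarith) 0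
    have hi := integrableOn_exp_mul_Ioi (a := -‖z‖ ^ 2) (by linarith) 0
    rw [← ofReal_integral_eq_lintegral_ofReal]
    · congr 1
      have : ∀ t : ℝ, -t * ‖z‖ ^ 2 = -‖z‖ ^ 2 * t := fun t => by ring
      simp_rw [this, h]
      simp [neg_div_neg_eq]
    · refine hi.congr (ae_of_all _ fun t => ?_)
      ring_nf
    · exact ae_of_all _ fun t => (Real.exp_pos _).le
  rw [lintegral_congr_ae h1, lintegral_lintegral_swap (by fun_prop)]
  have h2 : ∀ t ∈ Set.Ioi (0 : ℝ), ∫⁻ z, ENNReal.ofReal (Real.exp (-t * ‖z‖ ^ 2)) ∂(stdGaussian F)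
      = ENNReal.ofReal ((1 + 2 * t) ^ (-((Module.finrank ℝ F : ℝ) / 2))) := by
    intro t ht
    rw [← integral_exp_neg_mul_norm_sq_stdGaussian (le_of_lt ht),
      ofReal_integral_eq_lintegral_ofReal]
    · refine Integrable.of_bound (C := 1) (Measurable.aestronglyMeasurable (by fun_prop))
        (ae_of_all _ fun z => ?_)
      rw [Real.norm_eq_abs, Real.abs_exp, Real.exp_le_one_iff]
      have : 0 ≤ t * ‖z‖ ^ 2 := mul_nonneg (le_of_lt ht) (by positivity)
      linarith
    · exact ae_of_all _ fun t => (Real.exp_pos _).le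
  rw [setLIntegral_congr_fun measurableSet_Ioi h2]
  set d : ℝ := (Module.finrank ℝ F : ℝ)
  have hderiv : ∀ x ∈ Set.Ici (0 : ℝ), HasDerivAt
      (fun t : ℝ => -(1 / (d - 2)) * (1 + 2 * t) ^ (1 - d / 2)) ((1 + 2 * x) ^ (-(d / 2))) x := by
    intro x hx
    have hx' : (0 : ℝ) ≤ x := hx
    have h := ((((hasDerivAt_id x).const_mul 2).const_add 1).rpow_const (p := 1 - d / 2)
      (Or.inl (by simp; positivity))).const_mul (-(1 / (d - 2)))
    refine h.congr_deriv ?_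
    have : d - 2 ≠ 0 := by linarith
    rw [show (1 - d / 2 - 1 : ℝ) = -(d / 2) by ring]
    simp only [id]
    field_simp
    ring
  have htend : Tendsto (fun t : ℝ => -(1 / (d - 2)) * (1 + 2 * t) ^ (1 - d / 2)) atTop (𝓝 0) := by
    have : Tendsto (fun t : ℝ => 1 + 2 * t) atTop atTop :=
      tendsto_atTop_add_const_left _ _ (tendsto_id.const_mul_atTop (by norm_num))
    have h := ((tendsto_rpow_neg_atTop (y := d / 2 - 1) (by linarith)).comp this).const_mul
      (-(1 / (d - 2)))
    rw [mul_zero] at h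
    convert h using 4
    simp
  have hpos : ∀ x ∈ Set.Ioi (0 : ℝ), 0 ≤ (1 + 2 * x) ^ (-(d / 2)) := by
    intro x hx
    have : (0 : ℝ) < x := hx
    positivity
  have hint := integrableOn_Ioi_deriv_of_nonneg' hderiv hpos htend
  have hval := integral_Ioi_of_hasDerivAt_of_tendsto' hderiv hint htend
  rw [← ofReal_integral_eq_lintegral_ofReal hint
    ((ae_restrict_mem measurableSet_Ioi).mono hpos), hval]
  simp

end StdGaussian

theorem measurePreserving_pi_insert {κ : Type*} [Fintype κ] [DecidableEq κ] {X : Type*}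
    [MeasurableSpace X] (ν : Measure X) [IsProbabilityMeasure ν] (k : κ) :
    MeasurePreserving (fun z : κ → X => (fun l : {l // l ≠ k} => z l, z k))
      (Measure.pi fun _ => ν) ((Measure.pi fun _ => ν).prod ν) := by
  have h := measurePreserving_piEquivPiSubtypeProd (fun _ : κ => ν) (fun l => l = k)
  have hu := measurePreserving_piUnique (X := fun _ : {l // l = k} => X) (fun _ => ν)
  rw [Subsingleton.elim (Subtype.fintype fun l => l = k) (Fintype.subtypeEq k)] at h
  exact Measure.measurePreserving_swap.comp ((hu.prod (MeasurePreserving.id _)).comp h)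

/-! ### Gram matrices and dual vectors. -/

section Gram

variable {E : Type*} [NormedAddCommGroup E] [InnerProductSpace ℝ E]
  {κ : Type*} [Fintype κ] [DecidableEq κ]

/-- The coefficients of the linear form `x ↦ (gram a)⁻¹ x` recombined with the vectors `a`: for
linearly independent `a` this is the vector of `span a` with `⟪a l, dualVector a x⟫ = x l`. -/
noncomputable def dualVector (a : κ → E) (x : κ → ℝ) : E :=
  ∑ l, ((Matrix.gram ℝ a)⁻¹ *ᵥ x) l • a l

theorem inner_dualVector {a : κ → E} (ha : LinearIndependent ℝ a) (x : κ → ℝ) (l : κ) :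
    inner ℝ (a l) (dualVector a x) = x l := by
  have hdet : IsUnit (Matrix.gram ℝ a).det :=
    (Matrix.det_gram_ne_zero_iff_linearIndependent.2 ha).isUnit
  have h : Matrix.gram ℝ a *ᵥ ((Matrix.gram ℝ a)⁻¹ *ᵥ x) = x := by
    rw [Matrix.mulVec_mulVec, Matrix.mul_nonsing_inv _ hdet, Matrix.one_mulVec]
  rw [dualVector, inner_sum]
  conv_rhs => rw [← h]
  simp only [Matrix.mulVec, dotProduct, Matrix.gram_apply, inner_smul_right]
  exact Finset.sum_congr rfl fun i _ => mul_comm _ _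

theorem norm_sq_dualVector {a : κ → E} (ha : LinearIndependent ℝ a) (x : κ → ℝ) :
    ‖dualVector a x‖ ^ 2 = x ⬝ᵥ (Matrix.gram ℝ a)⁻¹ *ᵥ x := by
  rw [← real_inner_self_eq_norm_sq]
  have h : inner ℝ (∑ l, ((Matrix.gram ℝ a)⁻¹ *ᵥ x) l • a l) (dualVector a x)
      = x ⬝ᵥ (Matrix.gram ℝ a)⁻¹ *ᵥ x := by
    simp only [sum_inner, inner_smul_left, inner_dualVector ha, dotProduct]
    exact Finset.sum_congr rfl fun i _ => mul_comm _ _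
  exact h

/-- A diagonal entry of the inverse of a Gram matrix is the inverse of the squared distance of the
corresponding vector to the span of the other ones. -/
theorem inv_gram_apply_self {a : κ → E} (ha : LinearIndependent ℝ a) [FiniteDimensional ℝ E]
    (k : κ) {U : Submodule ℝ E} (hU : U = Submodule.span ℝ (Set.range fun l : {l // l ≠ k} => a l)) :
    (Matrix.gram ℝ a)⁻¹ k k = 1 / ‖Uᗮ.orthogonalProjectionOnto (a k)‖ ^ 2 := by
  set v := dualVector a (Pi.single k 1)
  have hv : v ∈ Uᗮ := by
    rw [Submodule.mem_orthogonal]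
    intro u hu
    rw [hU] at hu
    induction hu using Submodule.span_induction with
    | mem x hx =>
      obtain ⟨l, rfl⟩ := hx
      simp [v, inner_dualVector ha, l.2]
    | zero => simp
    | add x y _ _ hx hy => rw [inner_add_left, hx, hy, add_zero]
    | smul c x _ hx => rw [inner_smul_left, hx, mul_zero]
  have hw : ∀ l, ((Matrix.gram ℝ a)⁻¹ *ᵥ Pi.single k 1) l = (Matrix.gram ℝ a)⁻¹ l k := by
    intro l; simp
  -- Since `v` lies in `Uᗮ`, projecting its expansion in the `a l` onto `Uᗮ` leaves `v` unchanged
  -- and kills every term except the `k`-th.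
  have hPv : v = ((Matrix.gram ℝ a)⁻¹ k k) • (Uᗮ.orthogonalProjectionOnto (a k) : E) := by
    have h1 : (Uᗮ.orthogonalProjectionOnto v : E) = v :=
      congrArg Subtype.val (Submodule.orthogonalProjectionOnto_mem_subspace_eq_self (⟨v, hv⟩ : Uᗮ))
    have h2 : Uᗮ.orthogonalProjectionOnto v
        = ((Matrix.gram ℝ a)⁻¹ k k) • Uᗮ.orthogonalProjectionOnto (a k) := by
      simp only [v, dualVector, map_sum, map_smul, hw]
      refine Finset.sum_eq_single k (fun l _ hl => ?_) (by simp)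
      have : a l ∈ U := hU ▸ Submodule.subset_span ⟨⟨l, hl⟩, rfl⟩
      rw [Submodule.orthogonalProjectionOnto_orthogonal_apply_eq_zero this, smul_zero]
    rw [← h1, h2]
    rfl
  have h1 : inner ℝ (a k) v = 1 := by simp [v, inner_dualVector ha]
  have h3 : inner ℝ (a k) (Uᗮ.orthogonalProjectionOnto (a k) : E)
      = ‖Uᗮ.orthogonalProjectionOnto (a k)‖ ^ 2 := by
    rw [← real_inner_self_eq_norm_sq]
    exact (Submodule.inner_orthogonalProjectionOnto_eq_of_mem_right _ _).symm
  rw [hPv, inner_smul_right, h3] at h1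
  exact eq_one_div_of_mul_eq_one_left h1

end Gram

/-- Cramer's rule expresses the entries through determinants. No invertibility is needed, because
inversion of reals is measurable with value `0` at `0`, in agreement with the inverse of a singular
matrix. -/
theorem measurable_inv_matrix_apply {α κ : Type*} [MeasurableSpace α] [Fintype κ] [DecidableEq κ]
    {M : α → Matrix κ κ ℝ} (hM : ∀ k l, Measurable fun a => M a k l) (k l : κ) :
    Measurable fun a => (M a)⁻¹ k l := by
  have hdet : ∀ N : α → Matrix κ κ ℝ, (∀ k l, Measurable fun a => N a k l) →
      Measurable fun a => (N a).det := by
    intro N hN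
    simp only [Matrix.det_apply]
    fun_prop
  simp only [Matrix.inv_def, Ring.inverse_eq_inv', Matrix.smul_apply, smul_eq_mul,
    Matrix.adjugate_apply]
  refine (hdet M hM).inv.mul (hdet _ fun i j => ?_)
  by_cases h : i = l
  · subst h
    simp
  · simpa [Matrix.updateRow_ne h] using hM i j

theorem card_ne_add_one {κ : Type*} [Fintype κ] [DecidableEq κ] (k : κ) :
    Fintype.card {l // l ≠ k} + 1 = Fintype.card κ := by
  have h := Set.card_ne_eq k
  have := Fintype.card_pos_iff.2 ⟨k⟩
  simp only [Set.coe_ofPred] at h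
  omega

theorem linearIndependent_of_ne {K V κ : Type*} [DivisionRing K] [AddCommGroup V] [Module K V]
    [DecidableEq κ] {z : κ → V} (k : κ) (h : LinearIndependent K fun l : {l // l ≠ k} => z l)
    (hk : z k ∉ Submodule.span K (Set.range fun l : {l // l ≠ k} => z l)) :
    LinearIndependent K z := by
  rw [← linearIndependent_equiv (Equiv.optionSubtypeNe k)]
  have := linearIndependent_option'.2 ⟨h, hk⟩
  convert this using 1
  ext o
  cases o <;> rfl

/-! ### Diagonal entries of the inverse of a Gaussian Gram matrix. -/

section

variable {E : Type*} [NormedAddCommGroup E] [InnerProductSpace ℝ E] [FiniteDimensional ℝ E]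
  [MeasurableSpace E] [BorelSpace E]

/-- The family indexed by `κ` with value `x` at `k` and `w` elsewhere. -/
def insertAt {κ : Type*} [DecidableEq κ] {X : Type*} (k : κ) (w : {l // l ≠ k} → X) (x : X) :
    κ → X :=
  fun l => if h : l = k then x else w ⟨l, h⟩

theorem insertAt_self {κ : Type*} [DecidableEq κ] {X : Type*} (k : κ) (w : {l // l ≠ k} → X)
    (x : X) : insertAt k w x k = x := by
  simp [insertAt]

theorem insertAt_ne {κ : Type*} [DecidableEq κ] {X : Type*} (k : κ) (w : {l // l ≠ k} → X)
    (x : X) : (fun l : {l // l ≠ k} => insertAt k w x l) = w := by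
  ext l
  simp [insertAt, l.2]

theorem insertAt_eq {κ : Type*} [DecidableEq κ] {X : Type*} (k : κ) (z : κ → X) :
    insertAt k (fun l : {l // l ≠ k} => z l) (z k) = z := by
  ext l
  by_cases h : l = k
  · subst h; simp [insertAt]
  · simp [insertAt, h]

theorem measurable_insertAt {κ : Type*} [DecidableEq κ] {X : Type*} [MeasurableSpace X] (k : κ) :
    Measurable fun p : ({l // l ≠ k} → X) × X => insertAt k p.1 p.2 := by
  refine measurable_pi_lambda _ fun l => ?_
  by_cases h : l = k
  · simp only [insertAt, h, dite_true]; fun_prop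
  · simp only [insertAt, h, dite_false]; fun_prop

theorem measurable_gram_apply {κ : Type*} (k l : κ) :
    Measurable fun z : κ → E => Matrix.gram ℝ z k l := by
  simp only [Matrix.gram_apply]
  fun_prop

theorem measurableSet_linearIndependent {κ : Type*} [Fintype κ] [DecidableEq κ] :
    MeasurableSet {z : κ → E | LinearIndependent ℝ z} := by
  have hm : Measurable fun z : κ → E => (Matrix.gram ℝ z).det := by
    simp only [Matrix.det_apply, Matrix.gram_apply]
    fun_prop
  simp_rw [← Matrix.det_gram_ne_zero_iff_linearIndependent (𝕜 := ℝ)]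
  exact (hm (measurableSet_singleton 0)).compl

theorem ae_linearIndependent_insertAt {κ : Type*} [Fintype κ] [DecidableEq κ]
    (h : Fintype.card κ ≤ Module.finrank ℝ E) (k : κ) {w : {l // l ≠ k} → E}
    (hw : LinearIndependent ℝ w) :
    ∀ᵐ x ∂(stdGaussian E), LinearIndependent ℝ (insertAt k w x) := by
  have hU : Submodule.span ℝ (Set.range w) ≠ ⊤ := by
    intro htop
    have h1 := finrank_span_eq_card hw
    rw [htop, finrank_top] at h1
    have := card_ne_add_one k
    omega
  have h0 := stdGaussian_submodule_eq_zero _ hU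
  have h1 : ∀ᵐ x ∂(stdGaussian E), x ∉ Submodule.span ℝ (Set.range w) := by
    rw [ae_iff]
    simpa using h0
  filter_upwards [h1] with x hx
  apply linearIndependent_of_ne k
  · rwa [insertAt_ne]
  · rwa [insertAt_ne, insertAt_self]

/-- Induction on the number of vectors: by Fubini, a new independent Gaussian vector almost surely
avoids the span of the previous ones, which is a proper subspace. -/
theorem ae_linearIndependent_stdGaussian {κ : Type*} [Fintype κ] [DecidableEq κ]
    (h : Fintype.card κ ≤ Module.finrank ℝ E) :
    ∀ᵐ z ∂(Measure.pi fun _ : κ => stdGaussian E), LinearIndependent ℝ z := by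
  induction hn : Fintype.card κ generalizing κ with
  | zero =>
    have := Fintype.card_eq_zero_iff.1 hn
    exact ae_of_all _ fun z => linearIndependent_empty_type
  | succ n ih =>
    have : Nonempty κ := Fintype.card_pos_iff.1 (by omega)
    obtain ⟨k⟩ := this
    have hc : Fintype.card {l // l ≠ k} = n := by
      have := card_ne_add_one k
      omega
    have ih' := ih (κ := {l // l ≠ k}) (by omega) hc
    have hp : ∀ᵐ p ∂((Measure.pi fun _ : {l // l ≠ k} => stdGaussian E).prod (stdGaussian E)),
        LinearIndependent ℝ (insertAt k p.1 p.2) := by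
      refine (Measure.ae_prod_iff_ae_ae ?_).2 ?_
      · exact measurable_insertAt k measurableSet_linearIndependent
      · filter_upwards [ih'] with w hw
        exact ae_linearIndependent_insertAt h k hw
    have := (measurePreserving_pi_insert (stdGaussian E) k).quasiMeasurePreserving.ae hp
    simpa only [insertAt_eq] using this

/-- With the other vectors fixed, the entry is `1 / ‖·‖²` of the projection of the `k`-th vector
onto the orthogonal complement of their span. That projection is standard Gaussian in dimension `d =
finrank E - card κ + 1`, and `d - 2` is the denominator; the hypothesis says that `d ≥ 3`. -/
theorem lintegral_inv_gram_apply_self {κ : Type*} [Fintype κ] [DecidableEq κ]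
    (h : Fintype.card κ + 2 ≤ Module.finrank ℝ E) (k : κ) :
    ∫⁻ z, ENNReal.ofReal ((Matrix.gram ℝ z)⁻¹ k k) ∂(Measure.pi fun _ : κ => stdGaussian E)
      = ENNReal.ofReal (1 / ((Module.finrank ℝ E : ℝ) - Fintype.card κ - 1)) := by
  have hm : Measurable fun z : κ → E => ENNReal.ofReal ((Matrix.gram ℝ z)⁻¹ k k) :=
    (measurable_inv_matrix_apply measurable_gram_apply k k).ennreal_ofReal
  have hm' : Measurable fun p : ({l // l ≠ k} → E) × E =>
      ENNReal.ofReal ((Matrix.gram ℝ (insertAt k p.1 p.2))⁻¹ k k) :=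
    hm.comp (measurable_insertAt k)
  have h1 := (measurePreserving_pi_insert (stdGaussian E) k).lintegral_comp hm'
  simp only [insertAt_eq] at h1
  rw [h1, lintegral_prod _ hm'.aemeasurable]
  have hc := card_ne_add_one k
  have h2 : ∀ᵐ w ∂(Measure.pi fun _ : {l // l ≠ k} => stdGaussian E),
      ∫⁻ x, ENNReal.ofReal ((Matrix.gram ℝ (insertAt k w x))⁻¹ k k) ∂(stdGaussian E)
        = ENNReal.ofReal (1 / ((Module.finrank ℝ E : ℝ) - Fintype.card κ - 1)) := by
    filter_upwards [ae_linearIndependent_stdGaussian (κ := {l // l ≠ k}) (E := E) (by omega)]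
      with w hw
    set U := Submodule.span ℝ (Set.range w)
    have h3 : ∀ᵐ x ∂(stdGaussian E), ENNReal.ofReal ((Matrix.gram ℝ (insertAt k w x))⁻¹ k k)
        = ENNReal.ofReal (1 / ‖Uᗮ.orthogonalProjectionOnto x‖ ^ 2) := by
      filter_upwards [ae_linearIndependent_insertAt (by omega) k hw] with x hx
      rw [inv_gram_apply_self hx k (U := U) (by rw [insertAt_ne]), insertAt_self]
    have hd := Submodule.finrank_add_finrank_orthogonal U
    have hUw : Module.finrank ℝ U = Fintype.card {l // l ≠ k} := finrank_span_eq_card hw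
    have h4 := lintegral_map (μ := stdGaussian E) (f := fun z : Uᗮ => ENNReal.ofReal (1 / ‖z‖ ^ 2))
      (g := Uᗮ.orthogonalProjectionOnto) (by fun_prop) (by fun_prop)
    rw [lintegral_congr_ae h3, ← h4, map_orthogonalProjectionOnto_stdGaussian,
      lintegral_one_div_norm_sq_stdGaussian (by omega)]
    congr 2
    have : (Module.finrank ℝ U : ℝ) + Module.finrank ℝ Uᗮ = Module.finrank ℝ E := by
      exact_mod_cast hd
    have h5 : (Module.finrank ℝ U : ℝ) + 1 = Fintype.card κ := by
      rw [hUw]; exact_mod_cast hc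
    linarith
  rw [lintegral_congr_ae h2, lintegral_const, measure_univ, mul_one]

end

/-! ### Dual vectors under a change of basis and under projection. -/

section Gram

variable {E : Type*} [NormedAddCommGroup E] [InnerProductSpace ℝ E]
  {κ : Type*} [Fintype κ] [DecidableEq κ]

/-- The vectors `∑ l, C k l • z l`. -/
def mixVectors (C : Matrix κ κ ℝ) (z : κ → E) (k : κ) : E := ∑ l, C k l • z l

omit [DecidableEq κ] in
theorem gram_mixVectors (C : Matrix κ κ ℝ) (z : κ → E) :
    Matrix.gram ℝ (mixVectors C z) = C * Matrix.gram ℝ z * Cᵀ := by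
  ext k l
  simp only [Matrix.gram_apply, mixVectors, sum_inner, inner_sum, inner_smul_left,
    inner_smul_right, Matrix.mul_apply, Matrix.transpose_apply, Finset.sum_mul, conj_trivial]
  refine Finset.sum_congr rfl fun i _ => ?_
  rw [Finset.mul_sum]
  exact Finset.sum_congr rfl fun i' _ => by ring

theorem linearIndependent_mixVectors {C : Matrix κ κ ℝ} (hC : IsUnit C.det) {z : κ → E}
    (hz : LinearIndependent ℝ z) : LinearIndependent ℝ (mixVectors C z) := by
  rw [← Matrix.det_gram_ne_zero_iff_linearIndependent (𝕜 := ℝ)] at hz ⊢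
  rw [gram_mixVectors, Matrix.det_mul, Matrix.det_mul, Matrix.det_transpose]
  exact mul_ne_zero (mul_ne_zero hC.ne_zero hz) hC.ne_zero

/-- Least squares prediction is invariant under an invertible change of covariates. This removes the
covariance matrix from the problem. Independence of `z` is not needed: a singular Gram matrix makes
both sides zero. -/
theorem dualVector_mixVectors {C : Matrix κ κ ℝ} (hC : IsUnit C.det) (z : κ → E) (x : κ → ℝ) :
    dualVector (mixVectors C z) (C *ᵥ x) = dualVector z x := by
  have hCt : IsUnit (Cᵀ).det := by rwa [Matrix.det_transpose]
  have h : ((Matrix.gram ℝ (mixVectors C z))⁻¹ *ᵥ (C *ᵥ x)) ᵥ* C = (Matrix.gram ℝ z)⁻¹ *ᵥ x := by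
    rw [gram_mixVectors, Matrix.mul_inv_rev, Matrix.mul_inv_rev, ← Matrix.mulVec_transpose,
      Matrix.mulVec_mulVec, Matrix.mulVec_mulVec, ← Matrix.mul_assoc, ← Matrix.mul_assoc,
      Matrix.mul_nonsing_inv _ hCt, Matrix.one_mul, Matrix.mul_assoc, Matrix.nonsing_inv_mul _ hC,
      Matrix.mul_one]
  rw [dualVector, dualVector, ← h]
  simp only [mixVectors, Finset.smul_sum, Matrix.vecMul, dotProduct, Finset.sum_smul, smul_smul]
  rw [Finset.sum_comm]

theorem dualVector_sum (a : κ → E) (x : κ → ℝ) :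
    dualVector a x = ∑ k, x k • dualVector a (Pi.single k 1) := by
  simp only [dualVector, Matrix.mulVec, dotProduct, Finset.smul_sum, Finset.sum_smul, smul_smul]
  rw [Finset.sum_comm]
  refine Finset.sum_congr rfl fun k _ => Finset.sum_congr rfl fun l _ => ?_
  rw [← Finset.sum_smul, Finset.sum_eq_single k]
  · simp [mul_comm]
  · intro i _ hi; simp [hi]
  · simp

theorem norm_sq_dualVector_single {a : κ → E} (ha : LinearIndependent ℝ a) (k : κ) :
    ‖dualVector a (Pi.single k 1)‖ ^ 2 = (Matrix.gram ℝ a)⁻¹ k k := by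
  rw [norm_sq_dualVector ha]
  simp

theorem norm_sq_dualVector_le (a : κ → E) (x : κ → ℝ) :
    ‖dualVector a x‖ ^ 2 ≤ (∑ k, x k ^ 2) * ∑ k, ‖dualVector a (Pi.single k 1)‖ ^ 2 := by
  rw [dualVector_sum]
  refine le_trans (pow_le_pow_left₀ (norm_nonneg _) (norm_sum_le _ _) 2) ?_
  simp only [norm_smul]
  refine le_trans (Finset.sum_mul_sq_le_sq_mul_sq _ _ _) ?_
  simp only [Real.norm_eq_abs, sq_abs]
  rfl

theorem dualVector_mem_span (a : κ → E) (x : κ → ℝ) :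
    dualVector a x ∈ Submodule.span ℝ (Set.range a) :=
  Submodule.sum_mem _ fun l _ => Submodule.smul_mem _ _ (Submodule.subset_span ⟨l, rfl⟩)

/-- Projecting the vectors of a family enlarges the norms of the dual vectors. -/
theorem norm_dualVector_le_of_projection (U : Submodule ℝ E) [U.HasOrthogonalProjection]
    {a : κ → E} (ha : LinearIndependent ℝ fun k => U.orthogonalProjectionOnto (a k))
    (x : κ → ℝ) :
    ‖dualVector a x‖ ≤ ‖dualVector (fun k => U.orthogonalProjectionOnto (a k)) x‖ := by
  have ha' : LinearIndependent ℝ a := ha.of_comp U.orthogonalProjectionOnto.toLinearMap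
  set v := dualVector a x
  set v' := dualVector (fun k => U.orthogonalProjectionOnto (a k)) x
  have h1 : ∀ l, inner ℝ (a l) (v - v') = 0 := by
    intro l
    rw [inner_sub_right, inner_dualVector ha', sub_eq_zero]
    have := inner_dualVector ha x l
    rw [← this]
    exact Submodule.inner_orthogonalProjectionOnto_eq_of_mem_right _ _
  have h2 : ∀ w ∈ Submodule.span ℝ (Set.range a), inner ℝ w (v - v' : E) = 0 := by
    intro w hw
    induction hw using Submodule.span_induction with
    | mem x hx => obtain ⟨l, rfl⟩ := hx; exact h1 l
    | zero => simp
    | add x y _ _ hx hy => rw [inner_add_left, hx, hy, add_zero]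
    | smul c x _ hx => rw [inner_smul_left, hx, mul_zero]
  -- Both vectors have the same inner products with the `a l`, and `v` lies in their span, so `‖v‖²
  -- = ⟪v, v'⟫`; Cauchy–Schwarz then gives the bound.
  have h4 := h2 v (dualVector_mem_span a x)
  rw [inner_sub_right, real_inner_self_eq_norm_sq, sub_eq_zero] at h4
  have h3 : ‖v‖ ^ 2 ≤ ‖v‖ * ‖v'‖ := h4 ▸ real_inner_le_norm v (v' : E)
  rcases (norm_nonneg v).eq_or_lt with h0 | h0
  · rw [← h0]; exact norm_nonneg _
  · rw [sq] at h3
    exact le_of_mul_le_mul_left h3 h0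

end Gram

/-! ### Mean squared norm of the dual vector for Gaussian designs. -/

section Gaussian

variable {E : Type*} [NormedAddCommGroup E] [InnerProductSpace ℝ E] [FiniteDimensional ℝ E]
  [MeasurableSpace E] [BorelSpace E] {κ : Type*} [Fintype κ]

/-- In an orthonormal basis of `F` each coordinate of the sum is a linear form in `x`, whose second
moment is the squared norm of its coefficient vector; the cross terms never appear. -/
theorem lintegral_sum_smul_stdGaussian {F : Type*} [NormedAddCommGroup F] [InnerProductSpace ℝ F]
    [FiniteDimensional ℝ F] (v : κ → F) :
    ∫⁻ x, ENNReal.ofReal (‖∑ k, x k • v k‖ ^ 2) ∂(stdGaussian (EuclideanSpace ℝ κ))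
      = ∑ k, ENNReal.ofReal (‖v k‖ ^ 2) := by
  set b := stdOrthonormalBasis ℝ F
  have h : ∀ x : EuclideanSpace ℝ κ, ‖∑ k, x k • v k‖ ^ 2
      = ∑ i, inner ℝ (WithLp.toLp 2 fun k => inner ℝ (b i) (v k) : EuclideanSpace ℝ κ) x ^ 2 := by
    intro x
    rw [← b.sum_sq_inner_right]
    refine Finset.sum_congr rfl fun i _ => ?_
    rw [inner_sum]
    simp [PiLp.inner_apply, inner_smul_right]
  simp_rw [h]
  simp_rw [ENNReal.ofReal_sum_of_nonneg (fun i _ => sq_nonneg _)]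
  rw [lintegral_finsetSum _ (fun i _ => by fun_prop)]
  simp_rw [lintegral_sq_inner_stdGaussian]
  rw [← ENNReal.ofReal_sum_of_nonneg (fun i _ => sq_nonneg _),
    ← ENNReal.ofReal_sum_of_nonneg (fun i _ => sq_nonneg _)]
  congr 1
  simp_rw [EuclideanSpace.real_norm_sq_eq]
  rw [Finset.sum_comm]
  exact Finset.sum_congr rfl fun k _ => b.sum_sq_inner_right _

variable [DecidableEq κ]

theorem lintegral_sum_inv_gram (h : Fintype.card κ + 2 ≤ Module.finrank ℝ E) :
    ∫⁻ z, ∑ k, ENNReal.ofReal (‖dualVector z (Pi.single k 1)‖ ^ 2)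
        ∂(Measure.pi fun _ : κ => stdGaussian E)
      = ENNReal.ofReal (Fintype.card κ / ((Module.finrank ℝ E : ℝ) - Fintype.card κ - 1)) := by
  have h1 : ∀ᵐ z ∂(Measure.pi fun _ : κ => stdGaussian E),
      ∑ k, ENNReal.ofReal (‖dualVector z (Pi.single k 1)‖ ^ 2)
        = ∑ k, ENNReal.ofReal ((Matrix.gram ℝ z)⁻¹ k k) := by
    filter_upwards [ae_linearIndependent_stdGaussian (κ := κ) (E := E) (by omega)] with z hz
    simp_rw [norm_sq_dualVector_single hz]
  rw [lintegral_congr_ae h1, lintegral_finsetSum _ (fun k _ =>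
    (measurable_inv_matrix_apply measurable_gram_apply k k).ennreal_ofReal)]
  simp_rw [lintegral_inv_gram_apply_self h]
  rw [Finset.sum_const, Finset.card_univ, nsmul_eq_mul, ← ENNReal.ofReal_natCast,
    ← ENNReal.ofReal_mul (by positivity), mul_one_div]

theorem Measurable.dualVector {α : Type*} [MeasurableSpace α] {f : α → κ → E} {g : α → κ → ℝ}
    (hf : Measurable f) (hg : Measurable g) : Measurable fun a => dualVector (f a) (g a) := by
  simp only [_root_.dualVector, Matrix.mulVec, dotProduct]
  have h : ∀ k l, Measurable fun a => (Matrix.gram ℝ (f a))⁻¹ k l :=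
    fun k l => measurable_inv_matrix_apply (M := fun a => Matrix.gram ℝ (f a))
      (fun k l => (measurable_gram_apply k l).comp hf) k l
  exact Finset.measurable_fun_sum _ fun l _ => (Finset.measurable_fun_sum _ fun k _ =>
    (h l k).mul (by fun_prop)).smul (by fun_prop)

theorem measurable_norm_sq_dualVector :
    Measurable fun p : (κ → E) × EuclideanSpace ℝ κ =>
      ENNReal.ofReal (‖dualVector p.1 p.2.ofLp‖ ^ 2) := by
  have : Measurable fun p : (κ → E) × EuclideanSpace ℝ κ => dualVector p.1 p.2.ofLp :=
    measurable_fst.dualVector (by fun_prop)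
  exact (this.norm.pow_const 2).ennreal_ofReal

/-- For Gaussian covariates the average of the squared norm of the dual vector at an independent
covariate vector is that of the trace of an inverse Wishart matrix. -/
theorem lintegral_norm_sq_dualVector_central {C : Matrix κ κ ℝ} (hC : IsUnit C.det)
    (h : Fintype.card κ + 2 ≤ Module.finrank ℝ E) :
    ∫⁻ p, ENNReal.ofReal (‖dualVector (mixVectors C p.1) (C *ᵥ p.2.ofLp)‖ ^ 2)
        ∂((Measure.pi fun _ : κ => stdGaussian E).prod (stdGaussian (EuclideanSpace ℝ κ)))
      = ENNReal.ofReal (Fintype.card κ / ((Module.finrank ℝ E : ℝ) - Fintype.card κ - 1)) := by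
  simp_rw [dualVector_mixVectors hC]
  refine (lintegral_prod _ measurable_norm_sq_dualVector.aemeasurable).trans ?_
  refine (lintegral_congr fun z => ?_).trans (lintegral_sum_inv_gram h)
  refine Eq.trans ?_ (lintegral_sum_smul_stdGaussian _)
  simp_rw [← dualVector_sum]

omit [DecidableEq κ] in
theorem lintegral_sum_sq_add_stdGaussian_lt_top (c : κ → ℝ) :
    ∫⁻ x, ENNReal.ofReal (∑ k, (c k + x k) ^ 2) ∂(stdGaussian (EuclideanSpace ℝ κ)) < ⊤ := by
  have hi : Integrable (fun x : EuclideanSpace ℝ κ => ∑ k, (c k + x k) ^ 2)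
      (stdGaussian (EuclideanSpace ℝ κ)) := by
    refine integrable_finsetSum _ fun k _ => MemLp.integrable_sq (MemLp.add (memLp_const _) ?_)
    exact IsGaussian.memLp_dual _ (EuclideanSpace.proj k : EuclideanSpace ℝ κ →L[ℝ] ℝ) 2 (by simp)
  refine lt_of_le_of_lt (lintegral_mono fun x => ?_) hi.hasFiniteIntegral
  exact Real.ofReal_le_enorm _

/-- Projecting onto the orthogonal complement of `u` erases the mean terms `m k • u` and leaves a
centred Gaussian design in one dimension less; hence `+ 3` and `- 2` in place of the `+ 2` and `- 1`
of the central case. Dual vectors only grow under this projection, and Cauchy–Schwarz then splits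
the bound into a factor of the design and a factor of the independent test covariate. -/
theorem lintegral_norm_sq_dualVector_le {C : Matrix κ κ ℝ} (hC : IsUnit C.det) (m : κ → ℝ)
    {u : E} (hu : u ≠ 0) (h : Fintype.card κ + 3 ≤ Module.finrank ℝ E) :
    (∀ᵐ z ∂(Measure.pi fun _ : κ => stdGaussian E),
      LinearIndependent ℝ fun k => mixVectors C z k + m k • u) ∧
    ∫⁻ p, ENNReal.ofReal
          (‖dualVector (fun k => mixVectors C p.1 k + m k • u) (m + C *ᵥ p.2.ofLp)‖ ^ 2)
        ∂((Measure.pi fun _ : κ => stdGaussian E).prod (stdGaussian (EuclideanSpace ℝ κ)))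
      ≤ ENNReal.ofReal (Fintype.card κ / ((Module.finrank ℝ E : ℝ) - Fintype.card κ - 2)) *
        ∫⁻ x, ENNReal.ofReal (∑ k, ((C⁻¹ *ᵥ m) k + x k) ^ 2)
          ∂(stdGaussian (EuclideanSpace ℝ κ)) := by
  set U : Submodule ℝ E := (Submodule.span ℝ {u})ᗮ
  have hrank : Module.finrank ℝ U + 1 = Module.finrank ℝ E := by
    rw [← Submodule.finrank_add_finrank_orthogonal (Submodule.span ℝ {u}),
      finrank_span_singleton hu, add_comm]
  have hP : MeasurePreserving (fun (z : κ → E) k => U.orthogonalProjectionOnto (z k))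
      (Measure.pi fun _ => stdGaussian E) (Measure.pi fun _ => stdGaussian U) :=
    measurePreserving_pi _ _ fun _ =>
      ⟨by fun_prop, map_orthogonalProjectionOnto_stdGaussian U⟩
  have hPu : U.orthogonalProjectionOnto u = 0 :=
    Submodule.orthogonalProjectionOnto_orthogonal_apply_eq_zero
      (Submodule.mem_span_singleton_self u)
  have hPa : ∀ z : κ → E, (fun k => U.orthogonalProjectionOnto (mixVectors C z k + m k • u))
      = mixVectors C fun k => U.orthogonalProjectionOnto (z k) := by
    intro z
    ext1 k
    simp only [map_add, map_smul, hPu, smul_zero, add_zero, mixVectors, map_sum]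
  have hli : ∀ᵐ z ∂(Measure.pi fun _ : κ => stdGaussian E),
      LinearIndependent ℝ fun k => U.orthogonalProjectionOnto (mixVectors C z k + m k • u) := by
    filter_upwards [hP.quasiMeasurePreserving.ae (ae_linearIndependent_stdGaussian
      (κ := κ) (E := U) (by omega))] with z hz
    rw [hPa]
    exact linearIndependent_mixVectors hC hz
  refine ⟨hli.mono fun z hz => hz.of_comp U.orthogonalProjectionOnto.toLinearMap, ?_⟩
  -- The test covariate keeps its mean; writing it as `C` times a whitened vector lets
  -- `dualVector_mixVectors` remove `C`.
  have hm : ∀ x : κ → ℝ, m + C *ᵥ x = C *ᵥ (C⁻¹ *ᵥ m + x) := by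
    intro x
    rw [Matrix.mulVec_add, Matrix.mulVec_mulVec, Matrix.mul_nonsing_inv _ hC, Matrix.one_mulVec]
  have hbound : ∀ᵐ p ∂((Measure.pi fun _ : κ => stdGaussian E).prod
      (stdGaussian (EuclideanSpace ℝ κ))), ENNReal.ofReal
        (‖dualVector (fun k => mixVectors C p.1 k + m k • u) (m + C *ᵥ p.2.ofLp)‖ ^ 2)
      ≤ (∑ k, ENNReal.ofReal
          (‖dualVector (fun k => U.orthogonalProjectionOnto (p.1 k)) (Pi.single k 1)‖ ^ 2)) *
        ENNReal.ofReal (∑ k, ((C⁻¹ *ᵥ m) k + p.2 k) ^ 2) := by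
    filter_upwards [Measure.quasiMeasurePreserving_fst.ae hli] with p hp
    rw [← ENNReal.ofReal_sum_of_nonneg fun k _ => sq_nonneg _, mul_comm,
      ← ENNReal.ofReal_mul (Finset.sum_nonneg fun k _ => sq_nonneg _)]
    refine ENNReal.ofReal_le_ofReal ?_
    refine (pow_le_pow_left₀ (norm_nonneg _) (norm_dualVector_le_of_projection U hp _) 2).trans ?_
    rw [hPa, hm, dualVector_mixVectors hC]
    exact norm_sq_dualVector_le _ _
  have hmeas : Measurable fun z : κ → U =>
      ∑ k, ENNReal.ofReal (‖dualVector z (Pi.single k 1)‖ ^ 2) := by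
    refine Finset.measurable_fun_sum _ fun k _ => ?_
    have : Measurable fun z : κ → U => dualVector z (Pi.single k 1) :=
      measurable_id.dualVector measurable_const
    exact (this.norm.pow_const 2).ennreal_ofReal
  refine (lintegral_mono_ae hbound).trans (le_of_eq ?_)
  have hmeas' : Measurable fun x : EuclideanSpace ℝ κ =>
      ENNReal.ofReal (∑ k, ((C⁻¹ *ᵥ m) k + x k) ^ 2) := by fun_prop
  refine (lintegral_prod_mul (hmeas.comp hP.measurable).aemeasurable hmeas'.aemeasurable).trans ?_
  congr 1
  refine (hP.lintegral_comp hmeas).trans ?_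
  rw [lintegral_sum_inv_gram (by omega)]
  congr 2
  rw [← hrank]
  push_cast
  ring

end Gaussian

/-! ### Rearranging independent noise: rows into columns, and averages over independent Gaussian
factors. -/

theorem measurePreserving_curry_pi {ι κ X : Type*} [Fintype ι] [Fintype κ] [MeasurableSpace X]
    (ν : Measure X) [IsProbabilityMeasure ν] :
    MeasurePreserving (MeasurableEquiv.curry ι κ X) (Measure.pi fun _ => ν)
      (Measure.pi fun _ => Measure.pi fun _ => ν) := by
  refine ⟨MeasurableEquiv.measurable _, ?_⟩
  have h := Measure.infinitePi_map_curry (ι := ι) (κ := κ) (fun _ _ => ν)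
  simpa only [Measure.infinitePi_eq_pi] using h

theorem measurePreserving_swap_pi {ι κ X : Type*} [Fintype ι] [Fintype κ] [MeasurableSpace X]
    (ν : Measure X) [IsProbabilityMeasure ν] :
    MeasurePreserving (fun (w : ι → κ → X) k i => w i k) (Measure.pi fun _ => Measure.pi fun _ => ν)
      (Measure.pi fun _ => Measure.pi fun _ => ν) := by
  have h1 := (measurePreserving_curry_pi (ι := ι) (κ := κ) ν).symm
  have h2 := measurePreserving_piCongrLeft (fun _ : κ × ι => ν) (Equiv.prodComm ι κ)
  exact (measurePreserving_curry_pi (ι := κ) (κ := ι) ν).comp (h2.comp h1)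

theorem measurePreserving_toLp_stdGaussian (ι : Type*) [Fintype ι] :
    MeasurePreserving (WithLp.toLp 2 : (ι → ℝ) → EuclideanSpace ℝ ι)
      (Measure.pi fun _ => gaussianReal 0 1) (stdGaussian (EuclideanSpace ℝ ι)) :=
  ⟨by fun_prop, map_pi_eq_stdGaussian⟩

/-- The columns of a matrix given by its rows. -/
def columns {ι κ : Type*} (w : ι → EuclideanSpace ℝ κ) (k : κ) : EuclideanSpace ℝ ι :=
  WithLp.toLp 2 fun i => w i k

/-- The columns of a matrix with i.i.d. standard Gaussian rows are i.i.d. standard Gaussian. -/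
theorem measurePreserving_columns (ι κ : Type*) [Fintype ι] [Fintype κ] :
    MeasurePreserving (columns (ι := ι) (κ := κ))
      (Measure.pi fun _ => stdGaussian (EuclideanSpace ℝ κ))
      (Measure.pi fun _ => stdGaussian (EuclideanSpace ℝ ι)) := by
  have h1 := measurePreserving_pi (ι := ι) _ _ fun _ => measurePreserving_toLp_stdGaussian κ
  have h2 := measurePreserving_pi (ι := κ) _ _ fun _ => measurePreserving_toLp_stdGaussian ι
  have h3 := measurePreserving_swap_pi (ι := ι) (κ := κ) (gaussianReal 0 1)
  have hm : Measurable (columns (ι := ι) (κ := κ)) := by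
    unfold columns
    fun_prop
  refine ⟨hm, ?_⟩
  rw [← h1.map_eq, Measure.map_map hm h1.measurable]
  exact (h2.comp h3).map_eq

theorem measurePreserving_prod_rearrange {A B C D : Type*} [MeasurableSpace A] [MeasurableSpace B]
    [MeasurableSpace C] [MeasurableSpace D] (a : Measure A) (b : Measure B) (c : Measure C)
    (d : Measure D) [SFinite a] [SFinite b] [SFinite c] [SFinite d] :
    MeasurePreserving (fun p : (A × B) × C × D => (((p.1.1, p.2.1), p.1.2), p.2.2))
      ((a.prod b).prod (c.prod d)) (((a.prod c).prod b).prod d) := by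
  have h1 := measurePreserving_prodAssoc a b (c.prod d)
  have h2 : MeasurePreserving MeasurableEquiv.prodAssoc.symm (b.prod (c.prod d))
      ((b.prod c).prod d) := (measurePreserving_prodAssoc b c d).symm
  have h3 := (Measure.measurePreserving_swap (μ := b) (ν := c)).prod (MeasurePreserving.id d)
  have h4 : MeasurePreserving MeasurableEquiv.prodAssoc.symm (a.prod ((c.prod b).prod d))
      ((a.prod (c.prod b)).prod d) := (measurePreserving_prodAssoc a (c.prod b) d).symm
  have h5 : MeasurePreserving MeasurableEquiv.prodAssoc.symm (a.prod (c.prod b))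
      ((a.prod c).prod b) := (measurePreserving_prodAssoc a c b).symm
  exact (h5.prod (MeasurePreserving.id d)).comp
    (h4.comp (((MeasurePreserving.id a).prod (h3.comp h2)).comp h1))

/-- The expectation of the squared difference of independent variables, one of them Gaussian. -/
theorem integral_sq_sub_gaussian {Ω : Type*} [MeasurableSpace Ω] (μ : Measure Ω)
    [IsProbabilityMeasure μ] {Y : Ω → ℝ} (hY : Measurable Y) (σ : ℝ)
    (hfin : ∫⁻ ω, ENNReal.ofReal (Y ω ^ 2) ∂μ < ⊤) :
    Integrable (fun p : Ω × ℝ => (σ * Y p.1 - σ * p.2) ^ 2) (μ.prod (gaussianReal 0 1)) ∧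
    ∫ p, (σ * Y p.1 - σ * p.2) ^ 2 ∂(μ.prod (gaussianReal 0 1))
      = σ ^ 2 * (1 + (∫⁻ ω, ENNReal.ofReal (Y ω ^ 2) ∂μ).toReal) := by
  have hY2 : Integrable (fun ω => Y ω ^ 2) μ :=
    (lintegral_ofReal_ne_top_iff_integrable (hY.pow_const 2).aestronglyMeasurable
      (ae_of_all _ fun ω => sq_nonneg _)).1 hfin.ne
  have hYi : Integrable Y μ :=
    ((memLp_two_iff_integrable_sq hY.aestronglyMeasurable).2 hY2).integrable (by norm_num)
  have hval : ∫ ω, Y ω ^ 2 ∂μ = (∫⁻ ω, ENNReal.ofReal (Y ω ^ 2) ∂μ).toReal :=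
    integral_eq_lintegral_of_nonneg_ae (ae_of_all _ fun ω => sq_nonneg _)
      (hY.pow_const 2).aestronglyMeasurable
  have hg : MemLp (fun x : ℝ => x) 2 (gaussianReal 0 1) := memLp_id_gaussianReal 2
  have hgi : Integrable (fun x : ℝ => x) (gaussianReal 0 1) := hg.integrable (by norm_num)
  have hg2 : ∫ x, x ^ 2 ∂(gaussianReal 0 1) = 1 := by
    have h := variance_of_integral_eq_zero (μ := gaussianReal 0 1) (X := fun x : ℝ => x)
      (by fun_prop) integral_id_gaussianReal
    rw [← h, variance_fun_id_gaussianReal]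
    simp
  have heq : ∀ p : Ω × ℝ, (σ * Y p.1 - σ * p.2) ^ 2
      = σ ^ 2 * (Y p.1 ^ 2 + p.2 ^ 2 - 2 * (Y p.1 * p.2)) := fun p => by ring
  have i1 : Integrable (fun p : Ω × ℝ => Y p.1 ^ 2) (μ.prod (gaussianReal 0 1)) :=
    hY2.comp_fst _
  have i2 : Integrable (fun p : Ω × ℝ => p.2 ^ 2) (μ.prod (gaussianReal 0 1)) :=
    hg.integrable_sq.comp_snd _
  have i3 : Integrable (fun p : Ω × ℝ => Y p.1 * p.2) (μ.prod (gaussianReal 0 1)) :=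
    hYi.mul_prod hgi
  have i12 : Integrable (fun p : Ω × ℝ => Y p.1 ^ 2 + p.2 ^ 2) (μ.prod (gaussianReal 0 1)) :=
    i1.add i2
  simp_rw [heq]
  refine ⟨(i12.sub (i3.const_mul 2)).const_mul _, ?_⟩
  rw [integral_const_mul, integral_sub i12 (i3.const_mul 2), integral_add i1 i2,
    integral_const_mul, integral_prod_mul (f := Y) (g := fun x => x), integral_id_gaussianReal]
  have e1 : ∫ p, Y p.1 ^ 2 ∂(μ.prod (gaussianReal 0 1)) = ∫ ω, Y ω ^ 2 ∂μ := by
    rw [integral_fun_fst (fun ω => Y ω ^ 2)]; simp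
  have e2 : ∫ p : Ω × ℝ, p.2 ^ 2 ∂(μ.prod (gaussianReal 0 1)) = 1 := by
    rw [integral_fun_snd (fun x : ℝ => x ^ 2), hg2]; simp
  rw [e1, e2, hval]
  ring

theorem lintegral_sq_inner_prod_stdGaussian {Ω E : Type*} [MeasurableSpace Ω] (μ : Measure Ω)
    [IsProbabilityMeasure μ] [NormedAddCommGroup E] [InnerProductSpace ℝ E]
    [FiniteDimensional ℝ E] [MeasurableSpace E] [BorelSpace E] {v : Ω → E} (hv : Measurable v) :
    ∫⁻ p, ENNReal.ofReal (inner ℝ (v p.1) p.2 ^ 2) ∂(μ.prod (stdGaussian E))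
      = ∫⁻ ω, ENNReal.ofReal (‖v ω‖ ^ 2) ∂μ := by
  have hm : Measurable fun p : Ω × E => ENNReal.ofReal (inner ℝ (v p.1) p.2 ^ 2) :=
    (((hv.comp measurable_fst).inner measurable_snd).pow_const 2).ennreal_ofReal
  rw [lintegral_prod _ hm.aemeasurable]
  exact lintegral_congr fun p => lintegral_sq_inner_stdGaussian (v p)

/-- Both integrals are read on a common noise space `V`: `S` builds the observations from the noise,
`T` sorts the noise into independent blocks on which the integral can be computed. -/
theorem integral_eq_of_measurePreserving {V P W : Type*} [MeasurableSpace V] [MeasurableSpace P]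
    [MeasurableSpace W] {v : Measure V} {p : Measure P} {w : Measure W} {S : V → P} {T : V → W}
    (hS : MeasurePreserving S v p) (hT : MeasurePreserving T v w) {f : P → ℝ} {F : W → ℝ}
    (hf : Measurable f) (hF : Integrable F w) (h : ∀ᵐ x ∂v, f (S x) = F (T x)) :
    Integrable f p ∧ ∫ x, f x ∂p = ∫ x, F x ∂w := by
  have hFT : Integrable (F ∘ T) v := (hT.integrable_comp hF.aestronglyMeasurable).2 hF
  constructor
  · rw [← hS.integrable_comp hf.aestronglyMeasurable]
    exact hFT.congr (h.mono fun x hx => hx.symm)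
  · rw [← hS.map_eq, integral_map hS.measurable.aemeasurable hf.aestronglyMeasurable,
      integral_congr_ae h, ← hT.map_eq, integral_map hT.measurable.aemeasurable]
    rw [hT.map_eq]
    exact hF.aestronglyMeasurable

/-! ### Risk of a well-specified least squares fit. -/

section Risk

variable {κ : Type} [Fintype κ] [DecidableEq κ]

/-- The prediction at `x` of the least squares fit on the sample `train`. -/
noncomputable def olsPredict {n : ℕ} (train : Fin n → (κ → ℝ) × ℝ) (x : κ → ℝ) : ℝ :=
  x ⬝ᵥ ols (Matrix.of fun i k => (train i).1 k) (fun i => (train i).2)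

/-- By symmetry of the Gram matrix, `x · (AᵀA)⁻¹ Aᵀ y` pairs the responses with `A (AᵀA)⁻¹ x`, which
is the dual vector of the columns of `A`. -/
theorem olsPredict_eq_inner {n : ℕ} (train : Fin n → (κ → ℝ) × ℝ) (x : κ → ℝ) :
    olsPredict train x
      = inner ℝ (dualVector (fun k => (WithLp.toLp 2 fun i => (train i).1 k :
          EuclideanSpace ℝ (Fin n))) x) (WithLp.toLp 2 fun i => (train i).2) := by
  set a : κ → EuclideanSpace ℝ (Fin n) := fun k => WithLp.toLp 2 fun i => (train i).1 k
  have hG : (Matrix.of fun i k => (train i).1 k)ᵀ * (Matrix.of fun i k => (train i).1 k)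
      = Matrix.gram ℝ a := by
    ext k l
    simp only [Matrix.mul_apply, Matrix.transpose_apply, Matrix.of_apply, Matrix.gram_apply, a,
      PiLp.inner_apply, RCLike.inner_apply, conj_trivial]
    exact Finset.sum_congr rfl fun i _ => mul_comm _ _
  have hs : ((Matrix.gram ℝ a)⁻¹)ᵀ = (Matrix.gram ℝ a)⁻¹ := by
    rw [Matrix.transpose_nonsing_inv]
    congr 1
  rw [olsPredict, ols, hG, Matrix.dotProduct_mulVec, ← Matrix.mulVec_transpose, hs, dualVector,
    sum_inner]
  refine Finset.sum_congr rfl fun l _ => ?_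
  rw [inner_smul_left]
  congr 1
  simp only [Matrix.mulVec, dotProduct, Matrix.transpose_apply, Matrix.of_apply, a,
      PiLp.inner_apply, RCLike.inner_apply, conj_trivial]
  exact Finset.sum_congr rfl fun i _ => mul_comm _ _

theorem measurable_olsPredict {n : ℕ} :
    Measurable fun t : (Fin n → (κ → ℝ) × ℝ) × (κ → ℝ) => olsPredict t.1 t.2 := by
  simp_rw [olsPredict_eq_inner]
  refine Measurable.inner (Measurable.dualVector ?_ measurable_snd) ?_
  · fun_prop
  · fun_prop

/-- The observation `(x, x · b + σ ε)` with `x = m + C z` built from the noise `(z, ε)`. -/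
def linObs (m : κ → ℝ) (C : Matrix κ κ ℝ) (b : κ → ℝ) (σ : ℝ) (q : EuclideanSpace ℝ κ × ℝ) :
    (κ → ℝ) × ℝ :=
  (m + C *ᵥ q.1.ofLp, (m + C *ᵥ q.1.ofLp) ⬝ᵥ b + σ * q.2)

omit [DecidableEq κ] in
theorem measurable_linObs (m : κ → ℝ) (C : Matrix κ κ ℝ) (b : κ → ℝ) (σ : ℝ) :
    Measurable (linObs m C b σ) := by
  unfold linObs
  simp only [Matrix.mulVec, dotProduct, Pi.add_apply]
  fun_prop

/-- The law of `(x, x · b + σ ε)` for `x = m + C z` and independent standard Gaussian `z`, `ε`. -/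
noncomputable def linModel (m : κ → ℝ) (C : Matrix κ κ ℝ) (b : κ → ℝ) (σ : ℝ) :
    Measure ((κ → ℝ) × ℝ) :=
  ((stdGaussian (EuclideanSpace ℝ κ)).prod (gaussianReal 0 1)).map (linObs m C b σ)

instance isProbabilityMeasure_linModel (m : κ → ℝ) (C : Matrix κ κ ℝ) (b : κ → ℝ) (σ : ℝ) :
    IsProbabilityMeasure (linModel m C b σ) :=
  Measure.isProbabilityMeasure_map (measurable_linObs m C b σ).aemeasurable

/-- The columns of the design matrix with rows `m + C z i`, in terms of the columns of `z`. -/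
noncomputable def designColumns (n : ℕ) (m : κ → ℝ) (C : Matrix κ κ ℝ)
    (z : κ → EuclideanSpace ℝ (Fin n)) (k : κ) : EuclideanSpace ℝ (Fin n) :=
  mixVectors C z k + m k • WithLp.toLp 2 fun _ => 1

omit [DecidableEq κ] in
theorem measurable_designColumns (n : ℕ) (m : κ → ℝ) (C : Matrix κ κ ℝ) :
    Measurable (designColumns n m C) := by
  unfold designColumns mixVectors
  fun_prop

omit [DecidableEq κ] in
theorem designColumns_columns {n : ℕ} (m : κ → ℝ) (C : Matrix κ κ ℝ) (b : κ → ℝ) (σ : ℝ)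
    (w : Fin n → EuclideanSpace ℝ κ × ℝ) :
    (fun k => (WithLp.toLp 2 fun i => (linObs m C b σ (w i)).1 k : EuclideanSpace ℝ (Fin n)))
      = designColumns n m C (columns fun i => (w i).1) := by
  ext k i
  simp [linObs, designColumns, mixVectors, columns, Matrix.mulVec, dotProduct, add_comm]

/-- The response vector is the combination of the columns with coefficients `b` plus noise. The dual
vector pairs with column `l` to `x l`, so the signal is predicted without error and only the noise
term survives. -/
theorem olsPredict_linObs_sub {n : ℕ} (m : κ → ℝ) (C : Matrix κ κ ℝ) (b : κ → ℝ) (σ : ℝ)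
    (w : Fin n → EuclideanSpace ℝ κ × ℝ)
    (h : LinearIndependent ℝ (designColumns n m C (columns fun i => (w i).1))) (x : κ → ℝ) :
    olsPredict (fun i => linObs m C b σ (w i)) x - x ⬝ᵥ b
      = σ * inner ℝ (dualVector (designColumns n m C (columns fun i => (w i).1)) x)
          (WithLp.toLp 2 fun i => (w i).2) := by
  have hy : (WithLp.toLp 2 fun i => (linObs m C b σ (w i)).2 : EuclideanSpace ℝ (Fin n))
      = ∑ l, b l • designColumns n m C (columns fun i => (w i).1) l
        + σ • WithLp.toLp 2 fun i => (w i).2 := by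
    rw [← designColumns_columns m C b σ]
    ext i
    simp [linObs, dotProduct, mul_comm]
  rw [olsPredict_eq_inner, designColumns_columns, hy, inner_add_right, inner_sum]
  simp_rw [inner_smul_right]
  have : ∀ l, inner ℝ (dualVector (designColumns n m C (columns fun i => (w i).1)) x)
      (designColumns n m C (columns fun i => (w i).1) l) = x l := by
    intro l
    rw [real_inner_comm, inner_dualVector h]
  simp_rw [this]
  rw [dotProduct_comm, dotProduct]
  ring

/-- The mean squared norm of the dual vector of the design at a new covariate vector: up to the
noise level, the excess risk of the least squares fit. -/
noncomputable def excessRisk (n : ℕ) (m : κ → ℝ) (C : Matrix κ κ ℝ) : ENNReal :=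
  ∫⁻ p, ENNReal.ofReal (‖dualVector (designColumns n m C p.1) (m + C *ᵥ p.2.ofLp)‖ ^ 2)
    ∂((Measure.pi fun _ : κ => stdGaussian (EuclideanSpace ℝ (Fin n))).prod
      (stdGaussian (EuclideanSpace ℝ κ)))

/-- The noise of a training sample and a test observation, sorted into the columns of the design
noise, the test covariate noise, the training noise and the test noise. -/
def sortNoise {n : ℕ} (v : (Fin n → EuclideanSpace ℝ κ × ℝ) × EuclideanSpace ℝ κ × ℝ) :
    (((κ → EuclideanSpace ℝ (Fin n)) × EuclideanSpace ℝ κ) × EuclideanSpace ℝ (Fin n)) × ℝ :=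
  (((columns fun i => (v.1 i).1, v.2.1), WithLp.toLp 2 fun i => (v.1 i).2), v.2.2)

omit [DecidableEq κ] in
theorem measurePreserving_sortNoise (n : ℕ) :
    MeasurePreserving (sortNoise (κ := κ) (n := n))
      ((Measure.pi fun _ => (stdGaussian (EuclideanSpace ℝ κ)).prod (gaussianReal 0 1)).prod
        ((stdGaussian (EuclideanSpace ℝ κ)).prod (gaussianReal 0 1)))
      ((((Measure.pi fun _ : κ => stdGaussian (EuclideanSpace ℝ (Fin n))).prod
        (stdGaussian (EuclideanSpace ℝ κ))).prod
        (stdGaussian (EuclideanSpace ℝ (Fin n)))).prod (gaussianReal 0 1)) := by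
  have h : MeasurePreserving (fun w : Fin n → EuclideanSpace ℝ κ × ℝ =>
      (columns fun i => (w i).1, (WithLp.toLp 2 fun i => (w i).2 : EuclideanSpace ℝ (Fin n))))
      (Measure.pi fun _ => (stdGaussian (EuclideanSpace ℝ κ)).prod (gaussianReal 0 1))
      ((Measure.pi fun _ => stdGaussian (EuclideanSpace ℝ (Fin n))).prod
        (stdGaussian (EuclideanSpace ℝ (Fin n)))) :=
    ((measurePreserving_columns (Fin n) κ).prod
      (measurePreserving_toLp_stdGaussian (Fin n))).comp
      (measurePreserving_arrowProdEquivProdArrow _ _ _ _ _)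
  exact (measurePreserving_prod_rearrange _ _ _ _).comp (h.prod (MeasurePreserving.id _))

/-- The prediction error of the least squares fit in terms of the sorted noise, divided by `σ` and
before subtraction of the test noise. -/
noncomputable def olsNoise (n : ℕ) (m : κ → ℝ) (C : Matrix κ κ ℝ)
    (p : ((κ → EuclideanSpace ℝ (Fin n)) × EuclideanSpace ℝ κ) × EuclideanSpace ℝ (Fin n)) : ℝ :=
  inner ℝ (dualVector (designColumns n m C p.1.1) (m + C *ᵥ p.1.2.ofLp)) p.2

theorem measurable_dualVector_designColumns (n : ℕ) (m : κ → ℝ) (C : Matrix κ κ ℝ) :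
    Measurable fun p : (κ → EuclideanSpace ℝ (Fin n)) × EuclideanSpace ℝ κ =>
      dualVector (designColumns n m C p.1) (m + C *ᵥ p.2.ofLp) := by
  refine Measurable.dualVector ((measurable_designColumns n m C).comp measurable_fst) ?_
  have : Measurable fun x : EuclideanSpace ℝ κ => C *ᵥ x.ofLp := by fun_prop
  exact measurable_const.add (this.comp measurable_snd)

theorem integral_sq_olsNoise_sub {n : ℕ} (m : κ → ℝ) (C : Matrix κ κ ℝ) (σ : ℝ)
    (hfin : excessRisk n m C < ⊤) :
    Integrable (fun p => (σ * olsNoise n m C p.1 - σ * p.2) ^ 2)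
      ((((Measure.pi fun _ : κ => stdGaussian (EuclideanSpace ℝ (Fin n))).prod
        (stdGaussian (EuclideanSpace ℝ κ))).prod
        (stdGaussian (EuclideanSpace ℝ (Fin n)))).prod (gaussianReal 0 1)) ∧
    ∫ p, (σ * olsNoise n m C p.1 - σ * p.2) ^ 2
        ∂((((Measure.pi fun _ : κ => stdGaussian (EuclideanSpace ℝ (Fin n))).prod
        (stdGaussian (EuclideanSpace ℝ κ))).prod
        (stdGaussian (EuclideanSpace ℝ (Fin n)))).prod (gaussianReal 0 1))
      = σ ^ 2 * (1 + (excessRisk n m C).toReal) := by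
  have hvm := measurable_dualVector_designColumns n m C
  have hY : Measurable (olsNoise n m C) := (hvm.comp measurable_fst).inner measurable_snd
  have hD : ∫⁻ p, ENNReal.ofReal (olsNoise n m C p ^ 2)
      ∂(((Measure.pi fun _ : κ => stdGaussian (EuclideanSpace ℝ (Fin n))).prod
        (stdGaussian (EuclideanSpace ℝ κ))).prod (stdGaussian (EuclideanSpace ℝ (Fin n))))
      = excessRisk n m C := by
    have h := lintegral_sq_inner_prod_stdGaussian
      ((Measure.pi fun _ : κ => stdGaussian (EuclideanSpace ℝ (Fin n))).prod
        (stdGaussian (EuclideanSpace ℝ κ))) hvm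
    simp only [excessRisk, olsNoise]
    rw [h]
  have h := integral_sq_sub_gaussian _ hY σ (hD.trans_lt hfin)
  rwa [hD] at h

/-- The integrated squared prediction error of the least squares fit. -/
theorem integral_sq_olsPredict_sub {n : ℕ} (m : κ → ℝ) (C : Matrix κ κ ℝ) (b : κ → ℝ) (σ : ℝ)
    (hli : ∀ᵐ z ∂(Measure.pi fun _ : κ => stdGaussian (EuclideanSpace ℝ (Fin n))),
      LinearIndependent ℝ (designColumns n m C z))
    (hfin : excessRisk n m C < ⊤) :
    Integrable (fun t : (Fin n → (κ → ℝ) × ℝ) × (κ → ℝ) × ℝ =>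
        (olsPredict t.1 t.2.1 - t.2.2) ^ 2)
      ((Measure.pi fun _ => linModel m C b σ).prod (linModel m C b σ)) ∧
    ∫ t, (olsPredict t.1 t.2.1 - t.2.2) ^ 2
        ∂((Measure.pi fun _ : Fin n => linModel m C b σ).prod (linModel m C b σ))
      = σ ^ 2 * (1 + (excessRisk n m C).toReal) := by
  have hS1 : MeasurePreserving (linObs m C b σ) _ (linModel m C b σ) :=
    ⟨measurable_linObs m C b σ, rfl⟩
  have hS := (measurePreserving_pi (ι := Fin n) _ _ fun _ => hS1).prod hS1
  have hT := measurePreserving_sortNoise (κ := κ) n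
  obtain ⟨hi, hv⟩ := integral_sq_olsNoise_sub m C σ hfin
  have hfm : Measurable fun t : (Fin n → (κ → ℝ) × ℝ) × (κ → ℝ) × ℝ =>
      (olsPredict t.1 t.2.1 - t.2.2) ^ 2 := by
    have : Measurable fun t : (Fin n → (κ → ℝ) × ℝ) × (κ → ℝ) × ℝ => olsPredict t.1 t.2.1 :=
      measurable_olsPredict.comp (measurable_fst.prodMk (measurable_fst.comp measurable_snd))
    exact (this.sub (measurable_snd.comp measurable_snd)).pow_const 2
  have h1 := ((measurePreserving_fst.comp measurePreserving_fst).comp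
    measurePreserving_fst).comp hT
  rw [← hv]
  refine integral_eq_of_measurePreserving hS hT hfm hi ?_
  filter_upwards [h1.quasiMeasurePreserving.ae hli] with v hv
  have h2 := olsPredict_linObs_sub m C b σ v.1 hv (m + C *ᵥ v.2.1.ofLp)
  have h3 : σ * olsNoise n m C (sortNoise v).1
      = olsPredict (fun i => linObs m C b σ (v.1 i)) (m + C *ᵥ v.2.1.ofLp)
        - (m + C *ᵥ v.2.1.ofLp) ⬝ᵥ b := h2.symm
  rw [h3]
  change (olsPredict (fun i => linObs m C b σ (v.1 i)) (m + C *ᵥ v.2.1.ofLp)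
    - ((m + C *ᵥ v.2.1.ofLp) ⬝ᵥ b + σ * v.2.2)) ^ 2 = (_ - σ * v.2.2) ^ 2
  ring

end Risk

/-! ### Consequences of conditional independence. -/

/-- Under almost every conditional law given `m` the two variables are independent in the ordinary
sense, so the product rule for expectations applies to each conditional law. -/
theorem condExp_mul_of_condIndepFun {Ω : Type*} {m mΩ : MeasurableSpace Ω} [StandardBorelSpace Ω]
    {hm : m ≤ mΩ} {μ : Measure Ω} [IsFiniteMeasure μ] {f g : Ω → ℝ} (hf : Measurable f)
    (hg : Measurable g) (h : CondIndepFun m hm f g μ) (hfi : Integrable f μ)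
    (hgi : Integrable g μ) (hfg : Integrable (f * g) μ) :
    μ[f * g | m] =ᵐ[μ] μ[f | m] * μ[g | m] := by
  have h1 := ae_eq_of_ae_eq_trim ((condIndepFun_iff_map_prod_eq_prod_map_map hf hg).1 h)
  filter_upwards [h1, condExp_ae_eq_integral_condExpKernel hm hfi,
    condExp_ae_eq_integral_condExpKernel hm hgi, condExp_ae_eq_integral_condExpKernel hm hfg]
    with ω h1 h2 h3 h4
  rw [Pi.mul_apply, h2, h3, h4]
  rw [Kernel.prod_apply, Kernel.map_apply _ (by fun_prop), Kernel.map_apply _ hf,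
    Kernel.map_apply _ hg] at h1
  exact ((indepFun_iff_map_prod_eq_prod_map_map hf.aemeasurable
    hg.aemeasurable).2 h1).integral_fun_mul_eq_mul_integral
    hf.aestronglyMeasurable hg.aestronglyMeasurable

/-- If `f` and `g` are conditionally independent given `m` and `h` is `m`-measurable, then
`a f + h` and `g` are uncorrelated as soon as `a f + h` has constant conditional expectation. -/
theorem integral_mul_of_condIndepFun {Ω : Type*} {m mΩ : MeasurableSpace Ω} [StandardBorelSpace Ω]
    {hm : m ≤ mΩ} {μ : Measure Ω} [IsProbabilityMeasure μ] {f g h : Ω → ℝ} (hf : Measurable f)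
    (hg : Measurable g) (hfg : CondIndepFun m hm f g μ) (hf2 : MemLp f 2 μ)
    (hg2 : MemLp g 2 μ) (hh2 : MemLp h 2 μ) (hh : StronglyMeasurable[m] h) (a c : ℝ)
    (hc : μ[a • f + h | m] =ᵐ[μ] fun _ => c) :
    ∫ ω, (a * f ω + h ω) * g ω ∂μ = c * ∫ ω, g ω ∂μ := by
  have hfi := hf2.integrable (by norm_num)
  have hgi := hg2.integrable (by norm_num)
  have hhi := hh2.integrable (by norm_num)
  have hfgi : Integrable (f * g) μ := hf2.integrable_mul hg2
  have hhgi : Integrable (h * g) μ := hh2.integrable_mul hg2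
  -- The product `f * g` splits by conditional independence and `h` is pulled out, which leaves `(a
  -- μ[f | m] + h) μ[g | m]`; the first factor is the constant `c`.
  have e : μ[a • (f * g) + h * g | m] =ᵐ[μ] fun ω => c * (μ[g | m]) ω := by
    filter_upwards [hc, condExp_add (hfi.smul a) hhi m, condExp_smul a f m (μ := μ),
      condExp_add (hfgi.smul a) hhgi m, condExp_smul a (f * g) m (μ := μ),
      condExp_mul_of_condIndepFun hf hg hfg hfi hgi hfgi,
      condExp_mul_of_stronglyMeasurable_left hh hhgi hgi] with ω h1 h2 h3 h4 h5 h6 h7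
    rw [condExp_of_stronglyMeasurable hm hh hhi] at h2
    simp only [Pi.add_apply, Pi.smul_apply, Pi.mul_apply, smul_eq_mul] at *
    rw [h4, h5, h6, h7, ← h1, h2, h3]
    ring
  calc ∫ ω, (a * f ω + h ω) * g ω ∂μ = ∫ ω, (a • (f * g) + h * g) ω ∂μ := by
        refine integral_congr_ae (ae_of_all _ fun ω => ?_)
        simp only [Pi.add_apply, Pi.smul_apply, Pi.mul_apply, smul_eq_mul]
        ring
    _ = ∫ ω, (μ[a • (f * g) + h * g | m]) ω ∂μ := (integral_condExp hm).symm
    _ = c * ∫ ω, g ω ∂μ := by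
        rw [integral_congr_ae e, integral_const_mul, integral_condExp hm]

theorem indepFun_of_map {V Ω A B : Type*} [MeasurableSpace V] [MeasurableSpace Ω]
    [MeasurableSpace A] [MeasurableSpace B] {v : Measure V} [IsFiniteMeasure v] {μ : Measure Ω}
    {T : V → Ω} (hT : MeasurePreserving T v μ) {f : Ω → A} {g : Ω → B} (hf : Measurable f)
    (hg : Measurable g) (h : IndepFun (f ∘ T) (g ∘ T) v) : IndepFun f g μ := by
  have : IsFiniteMeasure μ := hT.map_eq ▸ inferInstance
  rw [indepFun_iff_map_prod_eq_prod_map_map hf.aemeasurable hg.aemeasurable, ← hT.map_eq,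
    Measure.map_map (by fun_prop) hT.measurable, Measure.map_map hf hT.measurable,
    Measure.map_map hg hT.measurable]
  exact (indepFun_iff_map_prod_eq_prod_map_map (hf.comp hT.measurable).aemeasurable
    (hg.comp hT.measurable).aemeasurable).1 h

/-! ### The Gaussian linear model: vanishing of the coefficient and of the total Sobol index. -/

section GaussianLinearModel

variable {p : ℕ} (μ : EuclideanSpace ℝ (Fin p)) (S : Matrix (Fin p) (Fin p) ℝ) (β : Fin p → ℝ)
  (σ : ℝ≥0)

theorem measurePreserving_gaussianLinearModel :
    MeasurePreserving (fun z : EuclideanSpace ℝ (Fin p) × ℝ => (z.1, z.1.ofLp ⬝ᵥ β + z.2))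
      ((multivariateGaussian μ S).prod (gaussianReal 0 (σ ^ 2))) (gaussianLinearModel μ S β σ) := by
  refine ⟨?_, rfl⟩
  unfold dotProduct
  fun_prop

theorem measurePreserving_fst_gaussianLinearModel :
    MeasurePreserving (Prod.fst : Obs p → _) (gaussianLinearModel μ S β σ)
      (multivariateGaussian μ S) := by
  have h := measurePreserving_gaussianLinearModel μ S β σ
  refine ⟨measurable_fst, ?_⟩
  rw [← h.map_eq, Measure.map_map measurable_fst h.measurable]
  exact measurePreserving_fst.map_eq

/-- The noise `y - x · β` of an observation. -/
def obsNoise (z : Obs p) : ℝ := z.2 - z.1.ofLp ⬝ᵥ β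

theorem measurable_obsNoise : Measurable (obsNoise β) := by
  unfold obsNoise dotProduct
  fun_prop

theorem measurePreserving_obsNoise :
    MeasurePreserving (obsNoise β) (gaussianLinearModel μ S β σ) (gaussianReal 0 (σ ^ 2)) := by
  have h := measurePreserving_gaussianLinearModel μ S β σ
  refine ⟨measurable_obsNoise β, ?_⟩
  rw [← h.map_eq, Measure.map_map (measurable_obsNoise β) h.measurable]
  have : obsNoise β ∘ (fun z : EuclideanSpace ℝ (Fin p) × ℝ => (z.1, z.1.ofLp ⬝ᵥ β + z.2))
      = Prod.snd := by
    ext z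
    simp [obsNoise]
  rw [this]
  exact measurePreserving_snd.map_eq

theorem indepFun_obsNoise :
    IndepFun (obsNoise β) (fun z : Obs p => z.1) (gaussianLinearModel μ S β σ) := by
  have h := measurePreserving_gaussianLinearModel μ S β σ
  refine indepFun_of_map h (measurable_obsNoise β) measurable_fst ?_
  have : obsNoise β ∘ (fun z : EuclideanSpace ℝ (Fin p) × ℝ => (z.1, z.1.ofLp ⬝ᵥ β + z.2))
      = Prod.snd := by
    ext z
    simp [obsNoise]
  rw [this]
  exact (indepFun_prod (X := id) (Y := id) measurable_id measurable_id).symm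

theorem memLp_obsNoise : MemLp (obsNoise β) 2 (gaussianLinearModel μ S β σ) :=
  (memLp_id_gaussianReal 2).comp_measurePreserving (measurePreserving_obsNoise μ S β σ)

theorem integral_obsNoise : ∫ z, obsNoise β z ∂(gaussianLinearModel μ S β σ) = 0 := by
  have h := measurePreserving_obsNoise μ S β σ
  have h2 := integral_map (μ := gaussianLinearModel μ S β σ) (φ := obsNoise β)
    h.measurable.aemeasurable (f := fun x : ℝ => x) (by fun_prop)
  rw [← h2, h.map_eq, integral_id_gaussianReal]

theorem memLp_coord (k : Fin p) :
    MemLp (fun z : Obs p => z.1 k) 2 (gaussianLinearModel μ S β σ) :=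
  (IsGaussian.memLp_dual (multivariateGaussian μ S)
    (EuclideanSpace.proj k : EuclideanSpace ℝ (Fin p) →L[ℝ] ℝ) 2 (by simp)).comp_measurePreserving
    (measurePreserving_fst_gaussianLinearModel μ S β σ)

theorem memLp_dotProduct (v : Fin p → ℝ) :
    MemLp (fun z : Obs p => z.1.ofLp ⬝ᵥ v) 2 (gaussianLinearModel μ S β σ) := by
  unfold dotProduct
  exact memLp_finsetSum _ fun k _ => (memLp_coord μ S β σ k).mul_const (v k)

theorem memLp_response : MemLp (fun z : Obs p => z.2) 2 (gaussianLinearModel μ S β σ) := by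
  have h := (memLp_dotProduct μ S β σ β).add (memLp_obsNoise μ S β σ)
  refine h.congr_norm measurable_snd.aestronglyMeasurable (ae_of_all _ fun z => ?_)
  simp [obsNoise]

theorem dotProduct_eq_add_dropCoord (j : Fin p) (x : EuclideanSpace ℝ (Fin p)) (v : Fin p → ℝ) :
    x.ofLp ⬝ᵥ v = x j * v j + dropCoord j x ⬝ᵥ fun k => v k :=
  Fintype.sum_eq_add_sum_subtype_ne (fun k => x k * v k) j

theorem sigmaDrop_le_sigmaX (j : Fin p) : sigmaDrop j ≤ sigmaX p := by
  have h : Measurable[sigmaX p] fun z : Obs p => dropCoord j z.1 :=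
    (measurable_dropCoord j).comp (comap_measurable _)
  exact h.comap_le

theorem sigmaX_le : sigmaX p ≤ (inferInstance : MeasurableSpace (Obs p)) :=
  measurable_fst.comap_le

/-- The conditional expectation of the response given a sigma-algebra generated by covariates that
determine the regression function. -/
theorem condExp_response {m : MeasurableSpace (Obs p)} (hm : m ≤ sigmaX p)
    (hβ : StronglyMeasurable[m] fun z : Obs p => z.1.ofLp ⬝ᵥ β) :
    (gaussianLinearModel μ S β σ)[fun z : Obs p => z.2 | m]
      =ᵐ[gaussianLinearModel μ S β σ] fun z => z.1.ofLp ⬝ᵥ β := by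
  set P := gaussianLinearModel μ S β σ
  have hm' := hm.trans sigmaX_le
  have hi1 := (memLp_dotProduct μ S β σ β).integrable (by norm_num)
  have hi2 := (memLp_obsNoise μ S β σ).integrable (by norm_num)
  have hy : (fun z : Obs p => z.2) = (fun z : Obs p => z.1.ofLp ⬝ᵥ β) + obsNoise β := by
    ext z
    simp [obsNoise]
  have hind : Indep (MeasurableSpace.comap (obsNoise β) inferInstance) m P :=
    indep_of_indep_of_le_right ((IndepFun_iff_Indep _ _ _).1 (indepFun_obsNoise μ S β σ)) hm
  have h0 := condExp_indep_eq (f := obsNoise β) (measurable_obsNoise β).comap_le hm'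
    (comap_measurable (obsNoise β)).stronglyMeasurable hind
  rw [hy]
  filter_upwards [condExp_add hi1 hi2 m, h0] with z h1 h2
  rw [h1, Pi.add_apply, h2, integral_obsNoise, condExp_of_stronglyMeasurable hm' hβ hi1, add_zero]

/-- If `β j = 0` the total Sobol index of the coordinate `j` vanishes. -/
theorem totalSobolIndex_eq_zero (j : Fin p) (hj : β j = 0) :
    totalSobolIndex quadraticLoss (gaussianLinearModel μ S β σ) j = 0 := by
  have hX : StronglyMeasurable[sigmaX p] fun z : Obs p => z.1.ofLp ⬝ᵥ β := by
    have h : Measurable fun x : EuclideanSpace ℝ (Fin p) => x.ofLp ⬝ᵥ β := by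
      unfold dotProduct
      fun_prop
    exact (h.comp (comap_measurable _)).stronglyMeasurable
  have hD : StronglyMeasurable[sigmaDrop j] fun z : Obs p => z.1.ofLp ⬝ᵥ β := by
    have h : Measurable fun x : {k : Fin p // k ≠ j} → ℝ => x ⬝ᵥ fun k => β k := by
      unfold dotProduct
      fun_prop
    have he : (fun z : Obs p => z.1.ofLp ⬝ᵥ β)
        = (fun x : {k : Fin p // k ≠ j} → ℝ => x ⬝ᵥ fun k => β k) ∘
          fun z : Obs p => dropCoord j z.1 := by
      ext z
      simp [dotProduct_eq_add_dropCoord j, hj]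
    rw [he]
    exact (h.comp (comap_measurable _)).stronglyMeasurable
  have h1 := condExp_response μ S β σ le_rfl hX
  have h2 := condExp_response μ S β σ (sigmaDrop_le_sigmaX j) hD
  rw [totalSobolIndex, sub_eq_zero]
  refine integral_congr_ae ?_
  filter_upwards [h1, h2] with z h1 h2
  rw [h1, h2]

variable {S}

theorem covariance_dotProduct_coord (hS : S.PosSemidef) (v : Fin p → ℝ) (k : Fin p) :
    cov[fun x : EuclideanSpace ℝ (Fin p) => x.ofLp ⬝ᵥ v, fun x => x k; multivariateGaussian μ S]
      = (S *ᵥ v) k := by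
  have hm : ∀ l, MemLp (fun x : EuclideanSpace ℝ (Fin p) => x l) 2 (multivariateGaussian μ S) :=
    fun l => IsGaussian.memLp_dual _
      (EuclideanSpace.proj l : EuclideanSpace ℝ (Fin p) →L[ℝ] ℝ) 2 (by simp)
  unfold dotProduct
  rw [covariance_comm, covariance_fun_sum_right (fun l => (hm l).mul_const (v l)) (hm k)]
  simp_rw [covariance_mul_const_right, covariance_eval_multivariateGaussian hS]
  rfl

/-- The pair is jointly Gaussian, so zero covariances suffice. In the proof the scalar is viewed as
a family over `Unit`, to match the criterion for two Gaussian families. -/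
theorem indepFun_dotProduct_dropCoord (hS : S.PosSemidef) (j : Fin p) {v : Fin p → ℝ}
    (hv : ∀ k, k ≠ j → (S *ᵥ v) k = 0) :
    IndepFun (fun x : EuclideanSpace ℝ (Fin p) => x.ofLp ⬝ᵥ v) (dropCoord j)
      (multivariateGaussian μ S) := by
  have hin : ∀ x : EuclideanSpace ℝ (Fin p),
      innerSL ℝ (WithLp.toLp 2 v : EuclideanSpace ℝ (Fin p)) x = x.ofLp ⬝ᵥ v := by
    intro x
    simp [PiLp.inner_apply, dotProduct]
  have hG := (IsGaussian.hasGaussianLaw_id (μ := multivariateGaussian μ S)).map_fun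
    ((ContinuousLinearMap.pi fun _ : Unit =>
      (innerSL ℝ (WithLp.toLp 2 v : EuclideanSpace ℝ (Fin p)))).prod
      (ContinuousLinearMap.pi fun k : {k // k ≠ j} =>
        (EuclideanSpace.proj k.1 : EuclideanSpace ℝ (Fin p) →L[ℝ] ℝ)))
  have hG' : HasGaussianLaw (fun x : EuclideanSpace ℝ (Fin p) =>
      ((fun _ : Unit => x.ofLp ⬝ᵥ v), fun k : {k // k ≠ j} => x k.1))
      (multivariateGaussian μ S) := by
    refine hG.congr (ae_of_all _ fun x => ?_)
    exact Prod.ext (funext fun _ => hin x) rfl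
  have h := hG'.indepFun_of_covariance_eval fun _ k => by
    rw [covariance_dotProduct_coord μ hS, hv k k.2]
  exact h.comp (φ := fun f : Unit → ℝ => f ()) (ψ := id) (by fun_prop) measurable_id

/-- Under the conditional null hypothesis the coordinate has no effect in the linear model. -/
theorem coef_eq_zero_of_conditionalNull (hS : S.PosDef) (j : Fin p)
    (hnull : ConditionalNull (gaussianLinearModel μ S β σ) j) : β j = 0 := by
  set P := gaussianLinearModel μ S β σ
  -- With this choice the covariance of `x · v` with `x k` is `(S v) k`, that is, `1` for `k = j`
  -- and `0` otherwise: `x · v` is independent of `X^{-j}` and its covariance with `x · β` is `β j`.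
  set v : Fin p → ℝ := S⁻¹ *ᵥ Pi.single j 1
  have hSv : S *ᵥ v = Pi.single j 1 := by
    rw [Matrix.mulVec_mulVec, Matrix.mul_nonsing_inv _ hS.det_pos.ne'.isUnit, Matrix.one_mulVec]
  have hfst := measurePreserving_fst_gaussianLinearModel μ S β σ
  have hdot : Measurable fun x : EuclideanSpace ℝ (Fin p) => x.ofLp ⬝ᵥ v := by
    unfold dotProduct
    fun_prop
  have hind : IndepFun (fun z : Obs p => z.1.ofLp ⬝ᵥ v) (fun z : Obs p => dropCoord j z.1) P := by
    have h := indepFun_dotProduct_dropCoord μ hS.posSemidef j (v := v)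
      (fun k hk => by rw [hSv]; simp [hk])
    rw [indepFun_iff_map_prod_eq_prod_map_map hdot.aemeasurable
      (measurable_dropCoord j).aemeasurable, ← hfst.map_eq, Measure.map_map (by
        exact hdot.prodMk (measurable_dropCoord j)) measurable_fst,
      Measure.map_map hdot measurable_fst,
      Measure.map_map (measurable_dropCoord j) measurable_fst] at h
    exact (indepFun_iff_map_prod_eq_prod_map_map (hdot.comp measurable_fst).aemeasurable
      ((measurable_dropCoord j).comp measurable_fst).aemeasurable).2 h
  set h : Obs p → ℝ := fun z => dropCoord j z.1 ⬝ᵥ fun k => v k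
  have hdec : (v j • (fun z : Obs p => z.1 j) + h) = fun z => z.1.ofLp ⬝ᵥ v := by
    ext z
    simp [h, dotProduct_eq_add_dropCoord j, mul_comm]
  have hc : P[v j • (fun z : Obs p => z.1 j) + h | sigmaDrop j]
      =ᵐ[P] fun _ => ∫ z, z.1.ofLp ⬝ᵥ v ∂P := by
    rw [hdec]
    exact condExp_indep_eq (hdot.comp measurable_fst).comap_le (sigmaDrop_le j)
      (comap_measurable (fun z : Obs p => z.1.ofLp ⬝ᵥ v)).stronglyMeasurable hind
  have hh : StronglyMeasurable[sigmaDrop j] h := by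
    have h1 : Measurable fun x : {k : Fin p // k ≠ j} → ℝ => x ⬝ᵥ fun k => v k := by
      unfold dotProduct
      fun_prop
    exact (h1.comp (comap_measurable _)).stronglyMeasurable
  have hu2 := memLp_dotProduct μ S β σ v
  have hf2 := memLp_coord μ S β σ j
  have hy2 := memLp_response μ S β σ
  have hh2 : MemLp h 2 P := by
    refine (hu2.sub (hf2.const_mul (v j))).congr_norm ?_ (ae_of_all _ fun z => ?_)
    · exact (hh.mono (sigmaDrop_le j)).aestronglyMeasurable
    · simp [h, dotProduct_eq_add_dropCoord j, mul_comm]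
  -- Here `x · v = v j * x j + h` with `h` a function of `X^{-j}`, and its conditional expectation
  -- given `X^{-j}` is constant by independence. Hence `x · v` is uncorrelated with the response.
  have key := integral_mul_of_condIndepFun (by fun_prop) measurable_snd hnull hf2 hy2 hh2 hh
    (v j) _ hc
  have hcov0 : cov[fun z : Obs p => z.1.ofLp ⬝ᵥ v, fun z => z.2; P] = 0 := by
    rw [covariance_eq_sub hu2 hy2, sub_eq_zero, ← key]
    refine integral_congr_ae (ae_of_all _ fun z => ?_)
    simp [h, dotProduct_eq_add_dropCoord j, mul_comm]
  have hy : (fun z : Obs p => z.2) = (fun z : Obs p => ∑ k, z.1 k * β k) + obsNoise β := by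
    ext z
    simp [obsNoise, dotProduct]
  have hcovk : ∀ k, cov[fun z : Obs p => z.1.ofLp ⬝ᵥ v, fun z => z.1 k;
      gaussianLinearModel μ S β σ]
      = (Pi.single j 1 : Fin p → ℝ) k := by
    intro k
    rw [← hSv, ← covariance_dotProduct_coord μ hS.posSemidef, ← hfst.map_eq,
      covariance_map_fun hdot.aestronglyMeasurable (Measurable.aestronglyMeasurable (by fun_prop))
        measurable_fst.aemeasurable]
  have hcove : cov[fun z : Obs p => z.1.ofLp ⬝ᵥ v, obsNoise β; P] = 0 :=
    ((indepFun_obsNoise μ S β σ).symm.comp hdot measurable_id).covariance_eq_zero hu2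
      (memLp_obsNoise μ S β σ)
  rw [hy, covariance_add_right hu2 (memLp_finsetSum _ fun k _ =>
      (memLp_coord μ S β σ k).mul_const (β k)) (memLp_obsNoise μ S β σ), hcove, add_zero,
    covariance_fun_sum_right (fun k => (memLp_coord μ S β σ k).mul_const (β k)) hu2] at hcov0
  simp_rw [covariance_mul_const_right] at hcov0
  simp_rw [hcovk] at hcov0
  simpa [Pi.single_apply] using hcov0

end GaussianLinearModel

/-! ### Full and restricted observations as linear images of standard noise. -/

section Laws

open scoped MatrixOrder

variable {κ : Type} [Fintype κ] [DecidableEq κ]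

/-- The symmetric square root of a covariance matrix. -/
noncomputable def covRoot (S : Matrix κ κ ℝ) : Matrix κ κ ℝ := CFC.sqrt S

theorem isUnit_det_covRoot {S : Matrix κ κ ℝ} (hS : S.PosDef) : IsUnit (covRoot S).det := by
  unfold covRoot
  have h := CFC.sqrt_mul_sqrt_self S hS.posSemidef.nonneg
  have h2 := congrArg Matrix.det h
  rw [Matrix.det_mul] at h2
  exact (left_ne_zero_of_mul (h2 ▸ hS.det_pos.ne')).isUnit

/-- The Gaussian linear model with covariance `S` as a linear image of standard noise. -/
theorem measurePreserving_linModel (m : EuclideanSpace ℝ κ) (S : Matrix κ κ ℝ) (b : κ → ℝ)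
    (σ : ℝ≥0) :
    MeasurePreserving (fun q : EuclideanSpace ℝ κ × ℝ => (q.1.ofLp, q.1.ofLp ⬝ᵥ b + q.2))
      ((multivariateGaussian m S).prod (gaussianReal 0 (σ ^ 2)))
      (linModel m.ofLp (covRoot S) b σ) := by
  have h1 : MeasurePreserving (fun x => m + Matrix.toEuclideanCLM (𝕜 := ℝ) (covRoot S) x)
      (stdGaussian (EuclideanSpace ℝ κ)) (multivariateGaussian m S) := ⟨by fun_prop, rfl⟩
  have h2 : MeasurePreserving (fun x : ℝ => (σ : ℝ) * x) (gaussianReal 0 1)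
      (gaussianReal 0 (σ ^ 2)) := by
    refine ⟨by fun_prop, ?_⟩
    rw [gaussianReal_map_const_mul]
    congr 1
    · simp
    · ext; simp
  have hm : Measurable fun q : EuclideanSpace ℝ κ × ℝ => (q.1.ofLp, q.1.ofLp ⬝ᵥ b + q.2) := by
    unfold dotProduct
    fun_prop
  refine ⟨hm, ?_⟩
  rw [← (h1.prod h2).map_eq, Measure.map_map hm (h1.prod h2).measurable]
  rfl

/-- The image under a linear map is Gaussian, hence determined by its mean and its covariance form,
which is compared on the standard basis. -/
theorem map_dropCoord_multivariateGaussian {p : ℕ} (j : Fin p) (μ : EuclideanSpace ℝ (Fin p))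
    {S : Matrix (Fin p) (Fin p) ℝ} (hS : S.PosSemidef) :
    MeasurePreserving (fun x => (WithLp.toLp 2 (dropCoord j x) : EuclideanSpace ℝ {k // k ≠ j}))
      (multivariateGaussian μ S)
      (multivariateGaussian (WithLp.toLp 2 (dropCoord j μ))
        (S.submatrix (Subtype.val : {k // k ≠ j} → Fin p) Subtype.val)) := by
  set L : EuclideanSpace ℝ (Fin p) →L[ℝ] EuclideanSpace ℝ {k // k ≠ j} :=
    (PiLp.continuousLinearEquiv 2 ℝ (fun _ : {k // k ≠ j} => ℝ)).symm.toContinuousLinearMap ∘L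
      ContinuousLinearMap.pi fun k : {k // k ≠ j} =>
        (EuclideanSpace.proj k.1 : EuclideanSpace ℝ (Fin p) →L[ℝ] ℝ)
  have hL : (fun x => (WithLp.toLp 2 (dropCoord j x) : EuclideanSpace ℝ {k // k ≠ j})) = L := rfl
  rw [hL]
  refine ⟨by fun_prop, ?_⟩
  apply IsGaussian.ext
  · simp only [id_eq, integral_id_multivariateGaussian]
    rw [ContinuousLinearMap.integral_id_map, integral_id_multivariateGaussian]
    · rfl
    · exact IsGaussian.integrable_id
  · rw [← ContinuousLinearMap.toBilinForm_inj]
    refine LinearMap.BilinForm.ext_basis (EuclideanSpace.basisFun _ ℝ).toBasis fun i k => ?_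
    rw [ContinuousLinearMap.toBilinForm_apply, ContinuousLinearMap.toBilinForm_apply,
      covarianceBilin_apply_eq_cov, covariance_map]
    · have (i : {k // k ≠ j}) : (fun u => inner ℝ ((EuclideanSpace.basisFun _ ℝ).toBasis i) u) ∘
          L = fun u => u i.1 := by
        ext x
        simp [PiLp.inner_apply, ← hL, dropCoord]
      simp_rw [this, covariance_eval_multivariateGaussian hS,
        covarianceBilin_multivariateGaussian (hS.submatrix _)]
      simp
    any_goals exact Measurable.aestronglyMeasurable (by fun_prop)
    · fun_prop
    · exact IsGaussian.memLp_two_id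

variable {p : ℕ} (μ : EuclideanSpace ℝ (Fin p)) (S : Matrix (Fin p) (Fin p) ℝ) (β : Fin p → ℝ)
  (σ : ℝ≥0)

theorem measurePreserving_full :
    MeasurePreserving (fun z : Obs p => (z.1.ofLp, z.2)) (gaussianLinearModel μ S β σ)
      (linModel μ.ofLp (covRoot S) β σ) := by
  have h := measurePreserving_gaussianLinearModel μ S β σ
  have hm : Measurable fun z : Obs p => (z.1.ofLp, z.2) := by fun_prop
  refine ⟨hm, ?_⟩
  rw [← h.map_eq, Measure.map_map hm h.measurable]
  exact (measurePreserving_linModel μ S β σ).map_eq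

variable {S β}

/-- Because `β j = 0`, dropping the coordinate loses no signal: the restricted data follow a linear
model with the same `σ`. -/
theorem measurePreserving_drop (hS : S.PosSemidef) (j : Fin p) (hj : β j = 0) :
    MeasurePreserving (fun z : Obs p => (dropCoord j z.1, z.2)) (gaussianLinearModel μ S β σ)
      (linModel (dropCoord j μ) (covRoot (S.submatrix (Subtype.val : {k // k ≠ j} → Fin p)
        Subtype.val)) (fun k => β k) σ) := by
  have h := measurePreserving_gaussianLinearModel μ S β σ
  have hm : Measurable fun z : Obs p => (dropCoord j z.1, z.2) :=
    ((measurable_dropCoord j).comp measurable_fst).prodMk measurable_snd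
  have h1 := (measurePreserving_linModel (WithLp.toLp 2 (dropCoord j μ))
    (S.submatrix (Subtype.val : {k // k ≠ j} → Fin p) Subtype.val) (fun k => β k) σ).comp
    ((map_dropCoord_multivariateGaussian j μ hS).prod (MeasurePreserving.id _))
  refine ⟨hm, ?_⟩
  rw [← h.map_eq, Measure.map_map hm h.measurable, ← h1.map_eq]
  congr 1
  ext z
  · rfl
  · simp [dotProduct_eq_add_dropCoord j, hj]

end Laws

/-! ### Exact value and rate of the excess risk. -/

section Rates

variable {κ : Type} [Fintype κ] [DecidableEq κ]

omit [DecidableEq κ] in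
theorem designColumns_zero (n : ℕ) (C : Matrix κ κ ℝ) :
    designColumns n (0 : κ → ℝ) C = mixVectors C := by
  ext z k i
  simp [designColumns]

theorem excessRisk_central {n : ℕ} {C : Matrix κ κ ℝ} (hC : IsUnit C.det)
    (hn : Fintype.card κ + 2 ≤ n) :
    (∀ᵐ z ∂(Measure.pi fun _ : κ => stdGaussian (EuclideanSpace ℝ (Fin n))),
      LinearIndependent ℝ (designColumns n 0 C z)) ∧
    excessRisk n 0 C = ENNReal.ofReal (Fintype.card κ / ((n : ℝ) - Fintype.card κ - 1)) := by
  have hr : Module.finrank ℝ (EuclideanSpace ℝ (Fin n)) = n := by simp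
  have h := lintegral_norm_sq_dualVector_central (E := EuclideanSpace ℝ (Fin n)) hC (by omega)
  rw [hr] at h
  constructor
  · filter_upwards [ae_linearIndependent_stdGaussian (κ := κ)
      (E := EuclideanSpace ℝ (Fin n)) (by omega)] with z hz
    rw [designColumns_zero]
    exact linearIndependent_mixVectors hC hz
  · rw [← h, excessRisk]
    simp only [designColumns_zero, zero_add]

theorem excessRisk_le (m : κ → ℝ) {C : Matrix κ κ ℝ} (hC : IsUnit C.det) :
    ∃ K : ℝ, 0 ≤ K ∧ ∀ n : ℕ, Fintype.card κ + 3 ≤ n →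
      (∀ᵐ z ∂(Measure.pi fun _ : κ => stdGaussian (EuclideanSpace ℝ (Fin n))),
        LinearIndependent ℝ (designColumns n m C z)) ∧
      excessRisk n m C
        ≤ ENNReal.ofReal (Fintype.card κ / ((n : ℝ) - Fintype.card κ - 2) * K) := by
  -- The second moment of the whitened test covariate; it does not depend on `n`.
  set k := ∫⁻ x, ENNReal.ofReal (∑ k, ((C⁻¹ *ᵥ m) k + x k) ^ 2)
    ∂(stdGaussian (EuclideanSpace ℝ κ))
  have hK : k ≠ ⊤ := (lintegral_sum_sq_add_stdGaussian_lt_top (C⁻¹ *ᵥ m)).ne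
  refine ⟨k.toReal, ENNReal.toReal_nonneg, fun n hn => ?_⟩
  have hr : Module.finrank ℝ (EuclideanSpace ℝ (Fin n)) = n := by simp
  have hu : (WithLp.toLp 2 fun _ => 1 : EuclideanSpace ℝ (Fin n)) ≠ 0 := by
    intro h
    have := congrArg (fun v : EuclideanSpace ℝ (Fin n) => v ⟨0, by omega⟩) h
    simp at this
  have h := lintegral_norm_sq_dualVector_le hC m hu (hn.trans_eq hr.symm)
  rw [hr] at h
  have hn' : (Fintype.card κ : ℝ) + 3 ≤ n := by exact_mod_cast hn
  rw [ENNReal.ofReal_mul (div_nonneg (by positivity) (by linarith)), ENNReal.ofReal_toReal hK]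
  exact h

theorem excessRisk_rate (m : κ → ℝ) {C : Matrix κ κ ℝ} (hC : IsUnit C.det) :
    ∃ K : ℝ, ∀ᶠ n : ℕ in atTop,
      (∀ᵐ z ∂(Measure.pi fun _ : κ => stdGaussian (EuclideanSpace ℝ (Fin n))),
        LinearIndependent ℝ (designColumns n m C z)) ∧
      excessRisk n m C < ⊤ ∧ (excessRisk n m C).toReal ≤ K * (1 / (n : ℝ)) := by
  obtain ⟨K, hK0, hK⟩ := excessRisk_le m hC
  refine ⟨2 * Fintype.card κ * K, ?_⟩
  -- This threshold is exactly `n - card κ - 2 ≥ n / 2`, whence the factor `2` in the constant.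
  filter_upwards [eventually_ge_atTop (2 * Fintype.card κ + 4)] with n hn
  obtain ⟨h1, h2⟩ := hK n (by omega)
  have hn' : 2 * (Fintype.card κ : ℝ) + 4 ≤ n := by exact_mod_cast hn
  have hc : (0 : ℝ) ≤ Fintype.card κ := by positivity
  have hn0 : (0 : ℝ) < n := by linarith
  have hpos : (0 : ℝ) < (n : ℝ) - Fintype.card κ - 2 := by linarith
  have h3 : (0 : ℝ) ≤ Fintype.card κ / ((n : ℝ) - Fintype.card κ - 2) * K := by positivity
  refine ⟨h1, h2.trans_lt ENNReal.ofReal_lt_top, ?_⟩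
  refine (ENNReal.toReal_le_of_le_ofReal h3 h2).trans ?_
  have h4 : (Fintype.card κ : ℝ) / ((n : ℝ) - Fintype.card κ - 2)
      ≤ 2 * Fintype.card κ * (1 / (n : ℝ)) := by
    rw [mul_one_div, div_le_div_iff₀ hpos hn0]
    nlinarith
  calc _ ≤ 2 * Fintype.card κ * (1 / (n : ℝ)) * K := mul_le_mul_of_nonneg_right h4 hK0
    _ = _ := by ring

end Rates

/-! ### From the sampling scheme to the expectation of LOCO. -/

section Sampling

variable {p : ℕ} {Ω : Type*} [MeasurableSpace Ω] {Q : Measure Ω}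

/-- A training sample and one observation of an independent test sample. -/
theorem measurePreserving_train_test {X : Type*} [MeasurableSpace X] {P : Measure X}
    [IsProbabilityMeasure P] [IsProbabilityMeasure Q] {n N : ℕ} {train : Ω → Fin n → X}
    {test : Ω → Fin N → X} (htrain : HasLaw train (Measure.pi fun _ => P) Q)
    (htest : HasLaw test (Measure.pi fun _ => P) Q) (hindep : IndepFun train test Q) (i : Fin N) :
    HasLaw (fun ω => (train ω, test ω i)) ((Measure.pi fun _ => P).prod P) Q := by
  have hi : HasLaw (fun ω => test ω i) P Q :=
    HasLaw.comp (μ := Measure.pi fun _ : Fin N => P)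
      (measurePreserving_eval (fun _ => P) i).hasLaw htest
  refine ⟨htrain.aemeasurable.prodMk hi.aemeasurable, ?_⟩
  have h2 : IndepFun train (fun ω => test ω i) Q :=
    hindep.comp (φ := id) (ψ := fun f : Fin N → X => f i) measurable_id (measurable_pi_apply i)
  rw [(indepFun_iff_map_prod_eq_prod_map_map htrain.aemeasurable hi.aemeasurable).1 h2,
    htrain.map_eq, hi.map_eq]

/-- The expected squared prediction error at a test observation. -/
theorem integral_sq_olsPredict_test {κ : Type} [Fintype κ] [DecidableEq κ]
    [IsProbabilityMeasure Q] {X : Type*} [MeasurableSpace X] {P : Measure X}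
    [IsProbabilityMeasure P] {m : κ → ℝ} {C : Matrix κ κ ℝ} {b : κ → ℝ} {σ : ℝ}
    {φ : X → (κ → ℝ) × ℝ} (hφ : MeasurePreserving φ P (linModel m C b σ)) {n N : ℕ}
    {train : Ω → Fin n → X} {test : Ω → Fin N → X}
    (htrain : HasLaw train (Measure.pi fun _ => P) Q)
    (htest : HasLaw test (Measure.pi fun _ => P) Q) (hindep : IndepFun train test Q)
    (hli : ∀ᵐ z ∂(Measure.pi fun _ : κ => stdGaussian (EuclideanSpace ℝ (Fin n))),
      LinearIndependent ℝ (designColumns n m C z))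
    (hfin : excessRisk n m C < ⊤) (i : Fin N) :
    Integrable (fun ω => (olsPredict (fun l => φ (train ω l)) (φ (test ω i)).1
      - (φ (test ω i)).2) ^ 2) Q ∧
    ∫ ω, (olsPredict (fun l => φ (train ω l)) (φ (test ω i)).1 - (φ (test ω i)).2) ^ 2 ∂Q
      = σ ^ 2 * (1 + (excessRisk n m C).toReal) := by
  have h1 := measurePreserving_train_test htrain htest hindep i
  have h2 := (measurePreserving_pi (ι := Fin n) _ _ fun _ => hφ).prod hφ
  have h3 : HasLaw (fun ω => ((fun l => φ (train ω l)), φ (test ω i)))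
      ((Measure.pi fun _ => linModel m C b σ).prod (linModel m C b σ)) Q :=
    HasLaw.comp h2.hasLaw h1
  obtain ⟨hi, hv⟩ := integral_sq_olsPredict_sub m C b σ hli hfin
  rw [← h3.map_eq] at hi hv
  refine ⟨hi.comp_aemeasurable h3.aemeasurable, ?_⟩
  rw [integral_map h3.aemeasurable hi.aestronglyMeasurable] at hv
  exact hv

end Sampling

theorem integral_average_sub {Ω : Type*} [MeasurableSpace Ω] {Q : Measure Ω} {N : ℕ} (hN : 0 < N)
    {f g : Fin N → Ω → ℝ} {a b : ℝ} (hf : ∀ i, Integrable (f i) Q) (hfa : ∀ i, ∫ ω, f i ω ∂Q = a)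
    (hg : ∀ i, Integrable (g i) Q) (hgb : ∀ i, ∫ ω, g i ω ∂Q = b) :
    Integrable (fun ω => (1 / (N : ℝ)) * ∑ i, (f i ω - g i ω)) Q ∧
    ∫ ω, (1 / (N : ℝ)) * ∑ i, (f i ω - g i ω) ∂Q = a - b := by
  have h : ∀ i, Integrable (fun ω => f i ω - g i ω) Q := fun i => (hf i).sub (hg i)
  refine ⟨(integrable_finsetSum _ fun i _ => h i).const_mul _, ?_⟩
  rw [integral_const_mul, integral_finsetSum _ fun i _ => h i]
  simp_rw [integral_sub (hf _) (hg _), hfa, hgb]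
  rw [Finset.sum_const, Finset.card_univ, Fintype.card_fin, nsmul_eq_mul]
  have : (N : ℝ) ≠ 0 := by positivity
  field_simp

/-- The expectation of the LOCO statistic is the difference of the excess risks of the two fits. -/
theorem integral_locoOLS {p : ℕ} {j : Fin p} {μ : EuclideanSpace ℝ (Fin p)}
    {S : Matrix (Fin p) (Fin p) ℝ} (hS : S.PosDef) {β : Fin p → ℝ} {σ : ℝ≥0} (hj : β j = 0)
    {Ω : Type*} [MeasurableSpace Ω] {Q : Measure Ω} [IsProbabilityMeasure Q] {n N : ℕ}
    (hN : 0 < N) {train train' : Ω → Fin n → Obs p} {test : Ω → Fin N → Obs p}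
    (htrain : HasLaw train (Measure.pi fun _ => gaussianLinearModel μ S β σ) Q)
    (htrain' : HasLaw train' (Measure.pi fun _ => gaussianLinearModel μ S β σ) Q)
    (htest : HasLaw test (Measure.pi fun _ => gaussianLinearModel μ S β σ) Q)
    (hindep : IndepFun train test Q) (hindep' : IndepFun train' test Q)
    {C : Matrix (Fin p) (Fin p) ℝ} {C' : Matrix {k // k ≠ j} {k // k ≠ j} ℝ}
    (hC : covRoot S = C)
    (hC' : covRoot (S.submatrix (Subtype.val : {k // k ≠ j} → Fin p) Subtype.val) = C')
    (hli : ∀ᵐ z ∂(Measure.pi fun _ => stdGaussian (EuclideanSpace ℝ (Fin n))),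
      LinearIndependent ℝ (designColumns n μ.ofLp C z))
    (hfin : excessRisk n μ.ofLp C < ⊤)
    (hli' : ∀ᵐ z ∂(Measure.pi fun _ => stdGaussian (EuclideanSpace ℝ (Fin n))),
      LinearIndependent ℝ (designColumns n (dropCoord j μ) C' z))
    (hfin' : excessRisk n (dropCoord j μ) C' < ⊤) :
    Integrable (fun ω => locoOLS j (train ω) (train' ω) (test ω)) Q ∧
    ∫ ω, locoOLS j (train ω) (train' ω) (test ω) ∂Q
      = (σ : ℝ) ^ 2 * ((excessRisk n (dropCoord j μ) C').toReal
        - (excessRisk n μ.ofLp C).toReal) := by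
  have hφ := measurePreserving_full μ S β σ
  have hφ' := measurePreserving_drop μ σ hS.posSemidef j hj
  rw [hC] at hφ
  rw [hC'] at hφ'
  have hfull := fun i => integral_sq_olsPredict_test hφ htrain htest hindep hli hfin i
  have hdrop := fun i => integral_sq_olsPredict_test hφ' htrain' htest hindep' hli' hfin' i
  have h := integral_average_sub hN (fun i => (hdrop i).1) (fun i => (hdrop i).2)
    (fun i => (hfull i).1) (fun i => (hfull i).2)
  -- The two risks share the irreducible term `σ²`, which cancels in the difference.
  refine ⟨h.1, h.2.trans ?_⟩
  ring

/-- Each ratio `n / (n - c)` tends to `1`, so the limit is `s ((p - 1) - p)`. -/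
theorem tendsto_mul_locoBias (p : ℕ) (s : ℝ) :
    Tendsto (fun n : ℕ => (n : ℝ) *
      (s * (((p : ℝ) - 1) / ((n : ℝ) - p) - (p : ℝ) / ((n : ℝ) - p - 1)))) atTop (𝓝 (-s)) := by
  have h : ∀ c : ℝ, Tendsto (fun n : ℕ => (n : ℝ) / ((n : ℝ) - c)) atTop (𝓝 1) := by
    intro c
    have h1 : Tendsto (fun n : ℕ => 1 - c / (n : ℝ)) atTop (𝓝 1) := by
      simpa using (tendsto_const_div_atTop_nhds_zero_nat c).const_sub 1
    have h2 := h1.inv₀ one_ne_zero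
    rw [inv_one] at h2
    refine h2.congr' ?_
    filter_upwards [eventually_gt_atTop 0] with n hn
    have : (n : ℝ) ≠ 0 := by positivity
    rw [one_sub_div this, inv_div]
  have h1 := (((h p).const_mul ((p : ℝ) - 1)).sub ((h (p + 1)).const_mul (p : ℝ))).const_mul s
  have e : s * (((p : ℝ) - 1) * 1 - p * 1) = -s := by ring
  rw [e] at h1
  refine h1.congr fun n => ?_
  rw [sub_sub]
  ring

theorem lemma3 {p : ℕ} (j : Fin p)
    (μ : EuclideanSpace ℝ (Fin p)) (S : Matrix (Fin p) (Fin p) ℝ) (hS : S.PosDef)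
    (β : Fin p → ℝ) (σ : ℝ≥0)
    (hnull : ConditionalNull (gaussianLinearModel μ S β σ) j)
    {Ω : Type*} [MeasurableSpace Ω] (Q : Measure Ω) [IsProbabilityMeasure Q]
    (ntest : ℕ → ℕ) (hntest : ∀ n, 0 < ntest n)
    -- for each training size `n`: the training sample of the full regressor, the training sample
    -- of the restricted regressor (the same one, or another one), and the test sample
    (train train' : ∀ n, Ω → Fin n → Obs p) (test : ∀ n, Ω → Fin (ntest n) → Obs p)
    (htrain : ∀ n, HasLaw (train n) (Measure.pi fun _ => gaussianLinearModel μ S β σ) Q)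
    (htrain' : ∀ n, HasLaw (train' n) (Measure.pi fun _ => gaussianLinearModel μ S β σ) Q)
    (htest : ∀ n, HasLaw (test n) (Measure.pi fun _ => gaussianLinearModel μ S β σ) Q)
    (hindep : ∀ n, IndepFun (train n) (test n) Q)
    (hindep' : ∀ n, IndepFun (train' n) (test n) Q) :
    -- the expectation exists for large `n`
    (∀ᶠ n in atTop, Integrable (fun ω => locoOLS j (train n ω) (train' n ω) (test n ω)) Q) ∧
    -- `E[ψ̂] = ψ_TSI + O(1/n)`, and `ψ_TSI = 0`, so that `E[ψ̂] = O(1/n)`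
    (fun n : ℕ => (∫ ω, locoOLS j (train n ω) (train' n ω) (test n ω) ∂Q)
        - totalSobolIndex quadraticLoss (gaussianLinearModel μ S β σ) j)
      =O[atTop] (fun n : ℕ => 1 / (n : ℝ)) ∧
    totalSobolIndex quadraticLoss (gaussianLinearModel μ S β σ) j = 0 ∧
    (fun n : ℕ => ∫ ω, locoOLS j (train n ω) (train' n ω) (test n ω) ∂Q)
      =O[atTop] (fun n : ℕ => 1 / (n : ℝ)) ∧
    -- for centred covariates: the exact value, and the rate is not better than linear
    (μ = 0 →
      (∀ n : ℕ, p + 2 ≤ n →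
        Integrable (fun ω => locoOLS j (train n ω) (train' n ω) (test n ω)) Q ∧
        (∫ ω, locoOLS j (train n ω) (train' n ω) (test n ω) ∂Q)
            - totalSobolIndex quadraticLoss (gaussianLinearModel μ S β σ) j
          = (σ : ℝ) ^ 2 * (((p : ℝ) - 1) / ((n : ℝ) - p) - (p : ℝ) / ((n : ℝ) - p - 1))) ∧
      Tendsto (fun n : ℕ => (n : ℝ) * ∫ ω, locoOLS j (train n ω) (train' n ω) (test n ω) ∂Q)
        atTop (𝓝 (-(σ : ℝ) ^ 2))) := by
  have hj : β j = 0 := coef_eq_zero_of_conditionalNull μ β σ hS j hnull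
  have hT := totalSobolIndex_eq_zero μ S β σ j hj
  have hS' : (S.submatrix (Subtype.val : {k // k ≠ j} → Fin p) Subtype.val).PosDef :=
    hS.submatrix Subtype.val_injective
  obtain ⟨C, hCdef⟩ : ∃ C, covRoot S = C := ⟨_, rfl⟩
  obtain ⟨C', hCdef'⟩ : ∃ C', covRoot (S.submatrix (Subtype.val : {k // k ≠ j} → Fin p)
    Subtype.val) = C' := ⟨_, rfl⟩
  have hC : IsUnit C.det := hCdef ▸ isUnit_det_covRoot hS
  have hC' : IsUnit C'.det := hCdef' ▸ isUnit_det_covRoot hS'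
  have hloco := fun n => integral_locoOLS hS hj (hntest n) (htrain n) (htrain' n) (htest n)
    (hindep n) (hindep' n) hCdef hCdef'
  obtain ⟨K, hK⟩ := excessRisk_rate μ.ofLp hC
  obtain ⟨K', hK'⟩ := excessRisk_rate (dropCoord j μ) hC'
  have hint : ∀ᶠ n in atTop,
      Integrable (fun ω => locoOLS j (train n ω) (train' n ω) (test n ω)) Q := by
    filter_upwards [hK, hK'] with n h h'
    exact (hloco n h.1 h.2.1 h'.1 h'.2.1).1
  have hO : (fun n : ℕ => ∫ ω, locoOLS j (train n ω) (train' n ω) (test n ω) ∂Q)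
      =O[atTop] (fun n : ℕ => 1 / (n : ℝ)) := by
    refine IsBigO.of_bound ((σ : ℝ) ^ 2 * (K' + K)) ?_
    filter_upwards [hK, hK'] with n h h'
    rw [(hloco n h.1 h.2.1 h'.1 h'.2.1).2, norm_mul, Real.norm_of_nonneg (by positivity),
      mul_assoc, Real.norm_of_nonneg (by positivity : (0 : ℝ) ≤ 1 / (n : ℝ)), add_mul]
    refine mul_le_mul_of_nonneg_left ?_ (by positivity)
    exact (norm_sub_le _ _).trans (add_le_add
      ((Real.norm_of_nonneg ENNReal.toReal_nonneg).trans_le h'.2.2)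
      ((Real.norm_of_nonneg ENNReal.toReal_nonneg).trans_le h.2.2))
  refine ⟨hint, by simpa only [hT, sub_zero] using hO, hT, hO, fun hμ => ?_⟩
  have hexact : ∀ n : ℕ, p + 2 ≤ n →
      Integrable (fun ω => locoOLS j (train n ω) (train' n ω) (test n ω)) Q ∧
      (∫ ω, locoOLS j (train n ω) (train' n ω) (test n ω) ∂Q)
        = (σ : ℝ) ^ 2 * (((p : ℝ) - 1) / ((n : ℝ) - p) - (p : ℝ) / ((n : ℝ) - p - 1)) := by
    intro n hn
    have hcard := card_ne_add_one j
    rw [Fintype.card_fin] at hcard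
    have hμ0 : μ.ofLp = 0 := by rw [hμ]; rfl
    have hμ0' : dropCoord j μ = 0 := by rw [hμ]; rfl
    obtain ⟨h1, h2⟩ := excessRisk_central (n := n) hC (by rwa [Fintype.card_fin])
    obtain ⟨h1', h2'⟩ := excessRisk_central (n := n) hC' (by omega)
    rw [← hμ0] at h1 h2
    rw [← hμ0'] at h1' h2'
    obtain ⟨hi, hv⟩ := hloco n h1 (h2 ▸ ENNReal.ofReal_lt_top) h1' (h2' ▸ ENNReal.ofReal_lt_top)
    refine ⟨hi, ?_⟩
    have hn' : (p : ℝ) + 2 ≤ n := by exact_mod_cast hn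
    -- With `p - 1` covariates the denominator `n - card - 1` of the restricted fit becomes `n - p`.
    have hcard' : (Fintype.card {k // k ≠ j} : ℝ) = (p : ℝ) - 1 := by
      rw [eq_sub_iff_add_eq]
      exact_mod_cast hcard
    have hp : (1 : ℝ) ≤ p := by exact_mod_cast (by omega : 1 ≤ p)
    rw [hv, h2, h2', hcard', Fintype.card_fin, ENNReal.toReal_ofReal, ENNReal.toReal_ofReal]
    · congr 3
      ring
    · exact div_nonneg (by linarith) (by linarith)
    · exact div_nonneg (by linarith) (by linarith)
  refine ⟨fun n hn => ⟨(hexact n hn).1, by rw [hT, sub_zero]; exact (hexact n hn).2⟩, ?_⟩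
  refine (tendsto_mul_locoBias p ((σ : ℝ) ^ 2)).congr' ?_
  filter_upwards [eventually_ge_atTop (p + 2)] with n hn
  rw [(hexact n hn).2]
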